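/- Let $C\ge 1$, $K\ge 1$, let $p=(p_1,\dots,p_C)$ satisfy $\sum_{c=1}^C p_c=1$ and $0<p_c<1$ for $1\le c\le C-1$, and let $a>0$ be a constant (for instance $a=3/8$). **Model.** There are $K$ batches with numbers of trials $n_1,\dots,n_K$. Batch $j$ has a random perturbation vector $\varepsilon_j=(\varepsilon_{1j},\dots,\varepsilon_{(C-1)j})$ with $\mathbb E(\varepsilon_{cj})=0$; put $\varepsilon_{Cj}=-\sum_{c=1}^{C-1}\varepsilon_{cj}$ and assume that $p_c+\varepsilon_{cj}\in[0,1]$ almost surely for $1\le c\le C$. The vectors $\varepsilon_1,\dots,\varepsilon_K$ are independent, the count vectors $X_j=(X_{1j},\dots,X_{Cj})$, $1\le j\le K$, are independent, and conditionally on $\varepsilon_j$, $$X_j\sim\mathrm{Multinomial}(n_j;\,p_1+\varepsilon_{1j},\dots,p_C+\varepsilon_{Cj}).$$ Put $\hat p_{cj}=X_{cj}/n_j$, and let $L_j,\mu\in\mathbb R^{C-1}$ have the entries $$L_{cj}=\arcsin\frac{2\hat p_{cj}-1}{1+2a/n_j},\qquad \mu_c=\arcsin(2p_c-1),\qquad 1\le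 c\le C-1.$$ Let $\Xi_p$ be the $(C-1)\times(C-1)$ matrix with diagonal entries $p_c(1-p_c)$ and off-diagonal entries $-p_cp_{c'}$. Fix $j\in\{1,\dots,K\}$ and consider any sequence of such models (with $p$, $a$, $C$, $K$ fixed) along which $n_j\to\infty$. (i) Suppose that, for some positive definite matrix $\Xi_\varepsilon$, the Lebesgue density of $\sqrt{n_j}\,\varepsilon_j$ (existing for all large $n_j$) converges uniformly on $\mathbb R^{C-1}$ to the density of $\mathcal N_{C-1}(0,\Xi_\varepsilon)$. Then $$\sqrt{n_j+0.5}\,(L_j-\mu)\ \xrightarrow{\ \mathcal L\ }\ \mathcal N_{C-1}(0,\Sigma),$$ where $\Sigma$ is the (finite, positive semidefinite) covariance matrix with entries $$\Sigma_{cc'}=\frac{(\Xi_p+\Xi_\varepsilon)_{cc'}}{\sqrt{p_c(1-p_c)}\sqrt{p_{c'}(1-p_{c'})}}.$$ (ii) Suppose instead that all variances and covariances of $\varepsilon_{1j},\dots,\varepsilon_{(C-1)j}$ are $o(1/n_j)$. Then the same convergence in law holds with $\Sigma$ given by the formula of (i) with $\Xi_\varepsilon=0$; this $\Sigma$ is positive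 semidefinite, its diagonal entries are $1$, and its off-diagonal entries are $$\Sigma_{cc'}=-\sqrt{\frac{p_cp_{c'}}{(1-p_c)(1-p_{c'})}},\qquad c\ne c'.$$ -/

import Mathlib

open MeasureTheory ProbabilityTheory Filter

/-! There are `C = d + 1` categories, indexed by `Fin (d + 1)`; the last one is `Fin.last d`, and
the first `C - 1 = d` categories are `Fin.castSucc c` for `c : Fin d`. -/

/-- Probability mass function of the multinomial distribution with `n` trials and cell
probabilities `q`, at the vector of counts `x`. -/
noncomputable def multinomialMass {k : ℕ} (n : ℕ) (q : Fin k → ℝ) (x : Fin k → ℕ) : ℝ :=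
  if ∑ c, x c = n then (Nat.multinomial Finset.univ x : ℝ) * ∏ c, q c ^ x c else 0

/-- The cell probabilities `p_c + ε_c`, `c = 1, …, C`, where `ε = (ε_1, …, ε_{C-1})` is the
perturbation vector and `ε_C = -∑_{c < C} ε_c`. -/
noncomputable def cellProb {d : ℕ} (p : Fin (d + 1) → ℝ) (e : EuclideanSpace ℝ (Fin d)) :
    Fin (d + 1) → ℝ :=
  fun c => p c + (Fin.snoc (fun i => e i) (-∑ i, e i) : Fin (d + 1) → ℝ) c

/-- The batch model on a probability space `(Ω, P)`: `K` batches, the `j`-th one having `n j`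
trials, perturbation vector `ε j` and vector of counts `X j`. -/
structure IsBatchModel {d K : ℕ} (p : Fin (d + 1) → ℝ) {Ω : Type*} [MeasurableSpace Ω]
    (P : Measure Ω) (n : Fin K → ℕ) (ε : Fin K → Ω → EuclideanSpace ℝ (Fin d))
    (X : Fin K → Ω → Fin (d + 1) → ℕ) : Prop where
  measurable_perturbation : ∀ j, Measurable (ε j)
  measurable_counts : ∀ j, Measurable (X j)
  indep_perturbation : iIndepFun ε P
  indep_counts : iIndepFun X P
  /-- The perturbed cell probabilities lie in `[0, 1]`. -/
  cellProb_mem : ∀ j, ∀ᵐ ω ∂P, ∀ c, cellProb p (ε j ω) c ∈ Set.Icc (0 : ℝ) 1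
  /-- The perturbations are centred. -/
  mean_zero : ∀ j c, ∫ ω, ε j ω c ∂P = 0
  /-- Conditionally on `ε j`, the counts `X j` are multinomial with `n j` trials and cell
  probabilities `p + ε j`. -/
  conditional_law : ∀ j x,
    P⟦X j ⁻¹' {x} | MeasurableSpace.comap (ε j) inferInstance⟧
      =ᵐ[P] fun ω => multinomialMass (n j) (cellProb p (ε j ω)) x

/-- The Lebesgue density of the centred Gaussian distribution on `ℝ^d` with positive definite
covariance matrix `S`. -/
noncomputable def gaussianDensity {d : ℕ} (S : Matrix (Fin d) (Fin d) ℝ)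
    (x : EuclideanSpace ℝ (Fin d)) : ℝ :=
  (Real.sqrt ((2 * Real.pi) ^ d * S.det))⁻¹ *
    Real.exp (-(dotProduct x.ofLp (S⁻¹.mulVec x.ofLp)) / 2)

/-- The densities of the random vectors `√(n m) • ε m` (which exist for all large `m`) converge
uniformly on `ℝ^d`, as `m → ∞`, to the density of the centred Gaussian distribution with
covariance matrix `S`. -/
def ScaledDensityTendsto {d : ℕ} {Ω : ℕ → Type*} [∀ m, MeasurableSpace (Ω m)]
    (P : ∀ m, Measure (Ω m)) (n : ℕ → ℕ) (ε : ∀ m, Ω m → EuclideanSpace ℝ (Fin d))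
    (S : Matrix (Fin d) (Fin d) ℝ) : Prop :=
  ∃ f : ℕ → EuclideanSpace ℝ (Fin d) → ℝ,
    (∀ m, Measurable (f m)) ∧ (∀ m x, 0 ≤ f m x) ∧
    (∀ᶠ m in atTop, (P m).map (fun ω => Real.sqrt (n m) • ε m ω) =
      volume.withDensity (fun x => ENNReal.ofReal (f m x))) ∧
    TendstoUniformly f (gaussianDensity S) atTop

/-- The vector `L` with entries `arcsin ((2 p̂_c - 1) / (1 + 2a/n))`, `c = 1, …, C - 1`, where
`p̂_c = x_c / n` is the observed proportion of category `c`. -/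
noncomputable def arcsineTransform {d : ℕ} (a : ℝ) (n : ℕ) (x : Fin (d + 1) → ℕ) :
    EuclideanSpace ℝ (Fin d) :=
  WithLp.toLp 2 fun c =>
    Real.arcsin ((2 * ((x c.castSucc : ℝ) / n) - 1) / (1 + 2 * a / n))

/-- The centring vector `μ` with entries `arcsin (2 p_c - 1)`, `c = 1, …, C - 1`. -/
noncomputable def arcsineCentre {d : ℕ} (p : Fin (d + 1) → ℝ) : EuclideanSpace ℝ (Fin d) :=
  WithLp.toLp 2 fun c => Real.arcsin (2 * p c.castSucc - 1)

/-- The matrix `Ξ_p`: entries `p_c (1 - p_c)` on the diagonal and `-p_c p_{c'}` off it. -/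
def multinomialCov {d : ℕ} (p : Fin (d + 1) → ℝ) : Matrix (Fin d) (Fin d) ℝ :=
  Matrix.of fun c c' =>
    if c = c' then p c.castSucc * (1 - p c.castSucc) else -(p c.castSucc * p c'.castSucc)

/-- The matrix `Σ` with entries
`(Ξ_p + Ξ)_{c c'} / (√(p_c (1 - p_c)) √(p_{c'} (1 - p_{c'})))`. -/
noncomputable def arcsineLimitCov {d : ℕ} (p : Fin (d + 1) → ℝ) (Ξ : Matrix (Fin d) (Fin d) ℝ) :
    Matrix (Fin d) (Fin d) ℝ :=
  Matrix.of fun c c' =>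
    (multinomialCov p + Ξ) c c' /
      (Real.sqrt (p c.castSucc * (1 - p c.castSucc)) *
        Real.sqrt (p c'.castSucc * (1 - p c'.castSucc)))

open scoped Topology

/-! Write `√n (p̂ - p)` as `√n ε` plus multinomial noise that is centred given `ε`. Conditioning on
`ε`, its characteristic function at `t` is the expectation of `exp(i⟨√n ε, t⟩)` times the
conditional characteristic function of the noise (`sum_multinomialMass_mul_exp_inner`). The noise is
a sum of `n` bounded trials, so a Taylor expansion puts the second factor within `O(1/√n)` of a
Gaussian value whose variance depends continuously on `ε`. If the characteristic functions of `√n ε`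
converge to a Gaussian one, then `√n ε` is tight and `ε` is small with high probability. The second
factor may then be replaced by its value at `ε = 0`, namely `exp(-tᵀ Ξ_p t / 2)`. The limit is a
product, so the covariances add (`tendsto_charFun_scaledProportions`).

The delta method does the rest: `x ↦ arcsin (2x - 1)` has derivative `1/√(q(1-q))` at `q`, and the
corrections `2a/n` and `0.5` vanish in the limit (`tendstoUniformlyOn_arcsine`). Tightness turns
this locally uniform statement into convergence in law.

The two parts differ only in how the characteristic function of `√n ε` is handled. In (i) a Scheffé
argument passes from densities to Fourier transforms; in (ii) second moments tend to `0`, so the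
limit is the Gaussian with zero covariance. The common theorem therefore asks only for a positive
semidefinite `Ξ`. -/

/-! ### Perturbed cell probabilities and the multinomial mass function. -/

lemma sum_cellProb {d : ℕ} {p : Fin (d + 1) → ℝ} (hp : ∑ c, p c = 1)
    (e : EuclideanSpace ℝ (Fin d)) : ∑ c, cellProb p e c = 1 := by
  simp [cellProb, Finset.sum_add_distrib, hp, Fin.sum_univ_castSucc (f := Fin.snoc _ _)]

lemma measurable_cellProb {d : ℕ} (p : Fin (d + 1) → ℝ) : Measurable (cellProb p) := by
  refine measurable_pi_lambda _ fun c => ?_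
  refine Fin.lastCases ?_ (fun i => ?_) c
  · simp only [cellProb, Fin.snoc_last]
    fun_prop
  · simp only [cellProb, Fin.snoc_castSucc]
    fun_prop

/-- The multinomial theorem, as a generating function identity for `multinomialMass`. -/
lemma sum_multinomialMass_mul_prod_pow {k : ℕ} (n : ℕ) (q : Fin k → ℝ) (z : Fin k → ℂ) :
    ∑ x ∈ Finset.piAntidiag Finset.univ n, (multinomialMass n q x : ℂ) * ∏ c, z c ^ x c =
      (∑ c, (q c : ℂ) * z c) ^ n := by
  rw [Finset.sum_pow_eq_sum_piAntidiag]
  refine Finset.sum_congr rfl fun x hx => ?_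
  rw [Finset.mem_piAntidiag] at hx
  simp only [multinomialMass, hx.1, if_true]
  push_cast
  simp only [mul_pow, Finset.prod_mul_distrib]
  ring

lemma sum_multinomialMass {k : ℕ} (n : ℕ) {q : Fin k → ℝ} (hq : ∑ c, q c = 1) :
    ∑ x ∈ Finset.piAntidiag Finset.univ n, multinomialMass n q x = 1 := by
  have h := sum_multinomialMass_mul_prod_pow n q (fun _ => 1)
  simp only [one_pow, Finset.prod_const_one, mul_one] at h
  rw [← Complex.ofReal_sum, ← Complex.ofReal_sum, hq] at h
  exact_mod_cast h.trans (by simp : ((1 : ℝ) : ℂ) ^ n = 1)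

/-! ### The law of the counts, by conditioning on the perturbation. -/

section Counts

variable {d K : ℕ} {p : Fin (d + 1) → ℝ} {Ω : Type*} [MeasurableSpace Ω] {P : Measure Ω}
  [IsProbabilityMeasure P] {n : Fin K → ℕ} {ε : Fin K → Ω → EuclideanSpace ℝ (Fin d)}
  {X : Fin K → Ω → Fin (d + 1) → ℕ}

lemma IsBatchModel.integral_multinomialMass (h : IsBatchModel p P n ε X) (j : Fin K)
    (x : Fin (d + 1) → ℕ) :
    ∫ ω, multinomialMass (n j) (cellProb p (ε j ω)) x ∂P = P.real (X j ⁻¹' {x}) := by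
  rw [← integral_congr_ae (h.conditional_law j x)]
  exact integral_condExp_indicator (h.measurable_perturbation j)
    (h.measurable_counts j (measurableSet_singleton x))

omit [IsProbabilityMeasure P] in
lemma IsBatchModel.integrable_multinomialMass (h : IsBatchModel p P n ε X) (j : Fin K)
    (x : Fin (d + 1) → ℕ) :
    Integrable (fun ω => multinomialMass (n j) (cellProb p (ε j ω)) x) P :=
  Integrable.congr integrable_condExp (h.conditional_law j x)

/-- The model only prescribes conditional point masses. Those of the finitely many vectors with
total `n j` already sum to one, so nothing is left for other vectors, and expectations over counts
become finite sums. -/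
lemma IsBatchModel.ae_counts_mem (h : IsBatchModel p P n ε X) (hp : ∑ c, p c = 1) (j : Fin K) :
    ∀ᵐ ω ∂P, X j ω ∈ Finset.piAntidiag (Finset.univ : Finset (Fin (d + 1))) (n j) := by
  have h1 : P.real (X j ⁻¹' (Finset.piAntidiag (Finset.univ : Finset (Fin (d + 1))) (n j) :
      Set (Fin (d + 1) → ℕ))) = 1 := by
    have : P.real (X j ⁻¹' (Finset.piAntidiag (Finset.univ : Finset (Fin (d + 1))) (n j) :
        Set (Fin (d + 1) → ℕ))) =
        ∑ x ∈ Finset.piAntidiag (Finset.univ : Finset (Fin (d + 1))) (n j),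
          P.real (X j ⁻¹' {x}) := by
      rw [sum_measureReal_preimage_singleton]
      exact fun x _ => h.measurable_counts j (measurableSet_singleton x)
    rw [this]
    simp_rw [← h.integral_multinomialMass j]
    rw [← integral_finsetSum _ fun x _ => h.integrable_multinomialMass j x]
    simp [sum_multinomialMass (n j) (sum_cellProb hp _)]
  have hm : MeasurableSet (X j ⁻¹' (Finset.piAntidiag (Finset.univ : Finset (Fin (d + 1))) (n j) :
      Set (Fin (d + 1) → ℕ))) := h.measurable_counts j (Finset.measurableSet _)
  have h2 := (prob_compl_eq_zero_iff hm).2 ((ENNReal.toReal_eq_one_iff _).1 h1)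
  exact h2

/-- The expectation of a function of the counts, computed by conditioning on the perturbation. -/
lemma IsBatchModel.integral_comp_counts (h : IsBatchModel p P n ε X) (hp : ∑ c, p c = 1)
    (j : Fin K) (g : (Fin (d + 1) → ℕ) → ℂ) :
    ∫ ω, g (X j ω) ∂P = ∫ ω, ∑ x ∈ Finset.piAntidiag Finset.univ (n j),
      (multinomialMass (n j) (cellProb p (ε j ω)) x : ℂ) * g x ∂P := by
  have h1 : (fun ω => g (X j ω)) =ᵐ[P] fun ω => ∑ x ∈ Finset.piAntidiag Finset.univ (n j),
      (X j ⁻¹' {x}).indicator (fun _ => g x) ω := by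
    filter_upwards [h.ae_counts_mem hp j] with ω hω
    rw [Finset.sum_eq_single_of_mem _ hω]
    · simp
    · intro x _ hx
      exact Set.indicator_of_notMem (fun h' => hx h'.symm) _
  have hm : ∀ x, MeasurableSet (X j ⁻¹' {x}) :=
    fun x => h.measurable_counts j (measurableSet_singleton x)
  rw [integral_congr_ae h1, integral_finsetSum, integral_finsetSum]
  · refine Finset.sum_congr rfl fun x _ => ?_
    rw [integral_indicator (hm x), setIntegral_const, integral_mul_const, integral_complex_ofReal,
      h.integral_multinomialMass j x, Complex.real_smul]
  · exact fun x _ => ((h.integrable_multinomialMass j x).ofReal).mul_const _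
  · exact fun x _ => (integrable_const _).indicator (hm x)

end Counts

/-! ### Quantitative central limit estimate for characteristic functions. -/

/-- Telescoping: changing one factor at a time costs `‖z - w‖` each. A one-trial error of order
`n^(-3/2)` thus becomes `n^(-1/2)` after `n` trials. -/
lemma norm_pow_sub_pow_le_of_norm_le_one {z w : ℂ} (hz : ‖z‖ ≤ 1) (hw : ‖w‖ ≤ 1) (n : ℕ) :
    ‖z ^ n - w ^ n‖ ≤ n * ‖z - w‖ := by
  induction n with
  | zero => simp
  | succ n ih =>
    have h1 : z ^ (n + 1) - w ^ (n + 1) = z * (z ^ n - w ^ n) + (z - w) * w ^ n := by ring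
    rw [h1]
    refine (norm_add_le _ _).trans ?_
    rw [norm_mul, norm_mul, norm_pow]
    have h2 : ‖z‖ * ‖z ^ n - w ^ n‖ ≤ n * ‖z - w‖ :=
      (mul_le_of_le_one_left (norm_nonneg _) hz).trans ih
    have h3 : ‖z - w‖ * ‖w‖ ^ n ≤ ‖z - w‖ :=
      mul_le_of_le_one_right (norm_nonneg _) (pow_le_one₀ (norm_nonneg _) hw)
    push_cast
    linarith

lemma norm_sum_mul_exp_le_one {k : ℕ} {q : Fin k → ℝ} (hq : ∀ c, 0 ≤ q c) (hq1 : ∑ c, q c = 1)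
    (θ : Fin k → ℝ) : ‖∑ c, (q c : ℂ) * Complex.exp (θ c * Complex.I)‖ ≤ 1 := by
  refine (norm_sum_le _ _).trans ?_
  simp only [norm_mul, Complex.norm_exp_ofReal_mul_I, mul_one, Complex.norm_real, Real.norm_eq_abs,
    abs_of_nonneg (hq _), hq1, le_refl]

/-- The second order expansion of the characteristic function of a centred discrete distribution,
raised to the `n`-th power. -/
lemma norm_sum_mul_exp_pow_sub_exp_le {k : ℕ} {q : Fin k → ℝ} (hq : ∀ c, 0 ≤ q c)
    (hq1 : ∑ c, q c = 1) {s : Fin k → ℝ} (hs : ∑ c, q c * s c = 0) {M : ℝ}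
    (hM : ∀ c, |s c| ≤ M) {n : ℕ} (hn : 0 < n) :
    ‖(∑ c, (q c : ℂ) * Complex.exp ((s c / Real.sqrt n : ℝ) * Complex.I)) ^ n -
        Complex.exp (-((∑ c, q c * s c ^ 2) / 2 : ℝ))‖ ≤
      (M ^ 3 * Real.exp M + M ^ 4 * Real.exp (M ^ 2)) / Real.sqrt n := by
  have hn' : (1 : ℝ) ≤ n := by exact_mod_cast hn
  set r := Real.sqrt n with hr
  have hr1 : 1 ≤ r := Real.one_le_sqrt.2 hn'
  have hrr : r ^ 2 = n := Real.sq_sqrt (by positivity)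
  have hr0 : 0 < r := by linarith
  have hk : Nonempty (Fin k) := by
    by_contra hk
    rw [not_nonempty_iff] at hk
    simp at hq1
  have hM0 : 0 ≤ M := (abs_nonneg _).trans (hM hk.some)
  set v := ∑ c, q c * s c ^ 2 with hv
  have hv0 : 0 ≤ v := Finset.sum_nonneg fun c _ => mul_nonneg (hq c) (sq_nonneg _)
  have hvM : v ≤ M ^ 2 := by
    calc v ≤ ∑ c, q c * M ^ 2 := by
          refine Finset.sum_le_sum fun c _ => mul_le_mul_of_nonneg_left ?_ (hq c)
          exact sq_le_sq.2 ((hM c).trans (le_abs_self M))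
      _ = M ^ 2 := by rw [← Finset.sum_mul, hq1, one_mul]
  -- `z` is the characteristic function of one trial and `w` the `n`-th root of the Gaussian value;
  -- both are compared with `1 - v / (2n)`.
  set z := ∑ c, (q c : ℂ) * Complex.exp ((s c / r : ℝ) * Complex.I) with hz
  set w := Complex.exp (-(v / (2 * r ^ 2) : ℝ)) with hw
  have hwn : Complex.exp (-(v / 2 : ℝ)) = w ^ n := by
    rw [hw, ← Complex.exp_nat_mul]
    congr 1
    rw [show (n : ℂ) = ((r ^ 2 : ℝ) : ℂ) by rw [hrr]; simp]
    norm_cast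
    field_simp
  have hw1 : ‖w‖ ≤ 1 := by
    rw [hw, Complex.norm_exp]
    refine Real.exp_le_one_iff.2 ?_
    simp only [Complex.neg_re, Complex.ofReal_re]
    have : 0 ≤ v / (2 * r ^ 2) := by positivity
    linarith
  have hz1 : ‖z‖ ≤ 1 := norm_sum_mul_exp_le_one hq hq1 _
  have hzexp : ‖z - (1 - v / (2 * r ^ 2) : ℝ)‖ ≤ M ^ 3 * Real.exp M / r ^ 3 := by
    have h1 : z - (1 - v / (2 * r ^ 2) : ℝ) = ∑ c, (q c : ℂ) *
        (Complex.exp ((s c / r : ℝ) * Complex.I) -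
          ∑ m ∈ Finset.range 3, ((s c / r : ℝ) * Complex.I) ^ m / m.factorial) := by
      -- After summation over `c` the linear term vanishes because the scores are centred (`hs`),
      -- leaving `1 - v / (2r²)`.
      have h2 : ∀ c, (q c : ℂ) * (∑ m ∈ Finset.range 3,
          ((s c / r : ℝ) * Complex.I) ^ m / m.factorial) =
          ((q c : ℝ) : ℂ) + ((q c * s c : ℝ) : ℂ) * (Complex.I / r) -
            ((q c * s c ^ 2 : ℝ) : ℂ) * (1 / (2 * r ^ 2)) := by
        intro c
        simp [Finset.sum_range_succ, mul_pow, div_pow]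
        ring
      simp only [mul_sub, Finset.sum_sub_distrib, h2, Finset.sum_add_distrib, ← Finset.sum_mul,
        ← Complex.ofReal_sum, hq1, hs, ← hv, ← hz]
      push_cast
      ring
    rw [h1]
    refine (norm_sum_le _ _).trans ?_
    calc _ ≤ ∑ c, q c * (M ^ 3 * Real.exp M / r ^ 3) := by
          refine Finset.sum_le_sum fun c _ => ?_
          rw [norm_mul, Complex.norm_real, Real.norm_eq_abs, abs_of_nonneg (hq c)]
          refine mul_le_mul_of_nonneg_left ?_ (hq c)
          refine (Complex.norm_exp_sub_sum_le_norm_mul_exp _ 3).trans ?_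
          have h3 : ‖((s c / r : ℝ) : ℂ) * Complex.I‖ ≤ M / r := by
            rw [norm_mul, Complex.norm_I, mul_one, Complex.norm_real, Real.norm_eq_abs, abs_div,
              abs_of_pos hr0]
            exact div_le_div_of_nonneg_right (hM c) hr0.le
          have h4 : M / r ≤ M := div_le_self hM0 hr1
          calc _ ≤ (M / r) ^ 3 * Real.exp M := by gcongr; exact h3.trans h4
            _ = _ := by ring
      _ = _ := by rw [← Finset.sum_mul, hq1, one_mul]
  have hwexp : ‖w - (1 - v / (2 * r ^ 2) : ℝ)‖ ≤ M ^ 4 * Real.exp (M ^ 2) / r ^ 4 := by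
    have h1 := Complex.norm_exp_sub_sum_le_norm_mul_exp (-(v / (2 * r ^ 2) : ℝ)) 2
    have h2 : ‖-((v / (2 * r ^ 2) : ℝ) : ℂ)‖ ≤ M ^ 2 / r ^ 2 := by
      rw [norm_neg, Complex.norm_real, Real.norm_eq_abs, abs_of_nonneg (by positivity)]
      gcongr
      nlinarith
    have h3 : M ^ 2 / r ^ 2 ≤ M ^ 2 := div_le_self (by positivity) (one_le_pow₀ hr1)
    calc _ = ‖Complex.exp (-(v / (2 * r ^ 2) : ℝ)) -
          ∑ m ∈ Finset.range 2, (-((v / (2 * r ^ 2) : ℝ) : ℂ)) ^ m / m.factorial‖ := by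
          congr 1
          simp [Finset.sum_range_succ, hw, sub_eq_add_neg]
      _ ≤ _ := h1
      _ ≤ (M ^ 2 / r ^ 2) ^ 2 * Real.exp (M ^ 2) := by gcongr; exact h2.trans h3
      _ = _ := by ring
  have hzw : ‖z - w‖ ≤ M ^ 3 * Real.exp M / r ^ 3 + M ^ 4 * Real.exp (M ^ 2) / r ^ 4 := by
    have : z - w = (z - (1 - v / (2 * r ^ 2) : ℝ)) - (w - (1 - v / (2 * r ^ 2) : ℝ)) := by ring
    rw [this]
    exact (norm_sub_le _ _).trans (add_le_add hzexp hwexp)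
  rw [hwn]
  refine (norm_pow_sub_pow_le_of_norm_le_one hz1 hw1 n).trans ?_
  rw [← hrr]
  calc r ^ 2 * ‖z - w‖
      ≤ r ^ 2 * (M ^ 3 * Real.exp M / r ^ 3 + M ^ 4 * Real.exp (M ^ 2) / r ^ 4) := by gcongr
    _ = M ^ 3 * Real.exp M / r + M ^ 4 * Real.exp (M ^ 2) / r ^ 2 := by field_simp
    _ ≤ M ^ 3 * Real.exp M / r + M ^ 4 * Real.exp (M ^ 2) / r := by
        gcongr
        nlinarith
    _ = _ := by ring

/-! ### Tightness, and Lipschitz continuity of the complex exponential. -/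

/-- Bounded random variables that are uniformly small wherever a tight sequence is bounded have
expectations tending to zero. -/
lemma tendsto_integral_zero_of_isTightMeasureSet {E : Type*} [NormedAddCommGroup E]
    [MeasurableSpace E] [BorelSpace E] {Ω : ℕ → Type*} [∀ m, MeasurableSpace (Ω m)]
    {P : ∀ m, Measure (Ω m)} [∀ m, IsProbabilityMeasure (P m)] {Z : ∀ m, Ω m → E}
    (hZ : ∀ m, Measurable (Z m))
    (ht : IsTightMeasureSet (Set.range fun m => (P m).map (Z m)))
    {G : ∀ m, Ω m → ℂ} {B : ℝ} (hB : ∀ᶠ m in atTop, ∀ᵐ ω ∂P m, ‖G m ω‖ ≤ B)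
    (hG : ∀ R δ : ℝ, 0 < δ → ∀ᶠ m in atTop, ∀ᵐ ω ∂P m, ‖Z m ω‖ ≤ R → ‖G m ω‖ ≤ δ) :
    Tendsto (fun m => ∫ ω, G m ω ∂P m) atTop (𝓝 0) := by
  rw [Metric.tendsto_nhds]
  intro δ hδ
  -- A strictly positive bound is needed to divide by. Tail and bulk will each contribute at most `δ
  -- / 4`.
  obtain ⟨C, hC0, hC⟩ : ∃ C : ℝ, 0 < C ∧ B ≤ C :=
    ⟨|B| + 1, by positivity, by linarith [le_abs_self B]⟩
  have hsup := tendsto_measure_norm_gt_of_isTightMeasureSet ht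
  have hη : (0 : ENNReal) < ENNReal.ofReal (δ / (4 * C)) := by
    rw [ENNReal.ofReal_pos]; positivity
  obtain ⟨R, hR⟩ := (hsup.eventually_lt_const hη).exists
  have hPR : ∀ m, (P m).real {ω | R < ‖Z m ω‖} ≤ δ / (4 * C) := by
    intro m
    have h1 : (P m).map (Z m) {x | R < ‖x‖} ≤ ENNReal.ofReal (δ / (4 * C)) :=
      (le_iSup₂ (f := fun (μ : Measure E) (_ : μ ∈ Set.range fun m => (P m).map (Z m)) =>
        μ {x | R < ‖x‖}) ((P m).map (Z m)) ⟨m, rfl⟩).trans hR.le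
    rw [Measure.map_apply (hZ m) (measurableSet_lt measurable_const measurable_norm)] at h1
    exact ENNReal.toReal_le_of_le_ofReal (by positivity) h1
  filter_upwards [hB, hG R (δ / 4) (by positivity)] with m hBm hGm
  have hset : MeasurableSet {ω | R < ‖Z m ω‖} :=
    measurableSet_lt measurable_const (hZ m).norm
  have hbound : ‖∫ ω, G m ω ∂P m‖ ≤
      ∫ ω, (δ / 4 + {ω | R < ‖Z m ω‖}.indicator (fun _ => C) ω) ∂P m := by
    refine norm_integral_le_of_norm_le
      ((integrable_const _).add ((integrable_const _).indicator hset)) ?_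
    filter_upwards [hBm, hGm] with ω h1 h2
    by_cases h : R < ‖Z m ω‖
    · rw [Set.indicator_of_mem (by exact h)]
      linarith
    · rw [Set.indicator_of_notMem (by exact h)]
      linarith [h2 (not_lt.1 h)]
  rw [integral_add (integrable_const _) ((integrable_const _).indicator hset),
    integral_indicator hset, setIntegral_const, integral_const] at hbound
  simp only [probReal_univ, smul_eq_mul, one_mul] at hbound
  have h3 : (P m).real {ω | R < ‖Z m ω‖} * C ≤ δ / 4 := by
    calc _ ≤ δ / (4 * C) * C := by gcongr; exact hPR m
      _ = δ / 4 := by field_simp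
  rw [dist_zero_right]
  linarith

lemma norm_exp_ofReal_mul_I_sub_exp_le (x y : ℝ) :
    ‖Complex.exp (x * Complex.I) - Complex.exp (y * Complex.I)‖ ≤ |x - y| := by
  have h : Complex.exp (x * Complex.I) - Complex.exp (y * Complex.I) =
      Complex.exp (y * Complex.I) * (Complex.exp (Complex.I * (x - y : ℝ)) - 1) := by
    rw [mul_sub, ← Complex.exp_add, mul_one]
    push_cast
    ring_nf
  rw [h, norm_mul, Complex.norm_exp_ofReal_mul_I, one_mul]
  exact Real.norm_exp_I_mul_ofReal_sub_one_le

/-! ### The multinomial covariance matrix and consequences of the cell constraints. -/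

lemma sum_snoc_zero_mul {d : ℕ} (q : Fin (d + 1) → ℝ) (t : Fin d → ℝ) :
    ∑ c, q c * (Fin.snoc t 0 : Fin (d + 1) → ℝ) c = ∑ c : Fin d, q c.castSucc * t c := by
  simp [Fin.sum_univ_castSucc]

/-- The quadratic form of `multinomialCov p` is the variance of a function on the categories. -/
lemma dotProduct_multinomialCov {d : ℕ} {p : Fin (d + 1) → ℝ} (hp : ∑ c, p c = 1)
    (t : Fin d → ℝ) :
    t ⬝ᵥ (multinomialCov p).mulVec t =
      ∑ c, p c * ((Fin.snoc t 0 : Fin (d + 1) → ℝ) c -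
        ∑ c', p c' * (Fin.snoc t 0 : Fin (d + 1) → ℝ) c') ^ 2 := by
  -- Expanding around an arbitrary `b` keeps the algebra linear; it is used with `b` the mean score.
  have h1 : ∀ b : ℝ, ∑ c, p c * ((Fin.snoc t 0 : Fin (d + 1) → ℝ) c - b) ^ 2 =
      ∑ c : Fin d, p c.castSucc * t c ^ 2 - 2 * b * ∑ c : Fin d, p c.castSucc * t c + b ^ 2 := by
    intro b
    have h2 : ∀ c, p c * ((Fin.snoc t 0 : Fin (d + 1) → ℝ) c - b) ^ 2 =
        p c * (Fin.snoc t 0 : Fin (d + 1) → ℝ) c ^ 2 -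
          2 * b * (p c * (Fin.snoc t 0 : Fin (d + 1) → ℝ) c) + p c * b ^ 2 := fun c => by ring
    simp only [h2, Finset.sum_add_distrib, Finset.sum_sub_distrib, ← Finset.mul_sum,
      ← Finset.sum_mul, hp, sum_snoc_zero_mul, one_mul]
    simp [Fin.sum_univ_castSucc]
  rw [h1, sum_snoc_zero_mul]
  have h3 : ∀ c, (multinomialCov p).mulVec t c =
      p c.castSucc * t c - p c.castSucc * ∑ c' : Fin d, p c'.castSucc * t c' := by
    intro c
    have h4 : ∀ c', multinomialCov p c c' * t c' =
        (if c = c' then p c.castSucc * t c' else 0) - p c.castSucc * (p c'.castSucc * t c') := by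
      intro c'
      by_cases h : c = c'
      · subst h
        simp only [multinomialCov, Matrix.of_apply, if_true]
        ring
      · simp only [multinomialCov, Matrix.of_apply, h, if_false]
        ring
    simp only [Matrix.mulVec, dotProduct, h4, Finset.sum_sub_distrib, Finset.sum_ite_eq,
      Finset.mem_univ, if_true, ← Finset.mul_sum]
  have h5 : ∀ c, t c * (p c.castSucc * t c - p c.castSucc * ∑ c' : Fin d, p c'.castSucc * t c') =
      p c.castSucc * t c ^ 2 - (p c.castSucc * t c) * ∑ c' : Fin d, p c'.castSucc * t c' :=
    fun c => by ring
  simp only [dotProduct, h3, h5, Finset.sum_sub_distrib, ← Finset.sum_mul]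
  ring

lemma posSemidef_multinomialCov {d : ℕ} {p : Fin (d + 1) → ℝ} (hp : ∑ c, p c = 1)
    (hp0 : ∀ c, 0 ≤ p c) : (multinomialCov p).PosSemidef := by
  refine Matrix.PosSemidef.of_dotProduct_mulVec_nonneg ?_ fun t => ?_
  · ext c c'
    by_cases h : c = c'
    · subst h; simp [multinomialCov]
    · simp [multinomialCov, h, Ne.symm h, mul_comm]
  · rw [star_trivial, dotProduct_multinomialCov hp]
    exact Finset.sum_nonneg fun c _ => mul_nonneg (hp0 c) (sq_nonneg _)

/-- Since `p_c + ε_c` stays in `[0, 1]`, the perturbation is almost surely bounded and has all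
moments. -/
lemma IsBatchModel.memLp_perturbation {d K : ℕ} {p : Fin (d + 1) → ℝ} {Ω : Type*}
    [MeasurableSpace Ω] {P : Measure Ω} [IsProbabilityMeasure P] {n : Fin K → ℕ}
    {ε : Fin K → Ω → EuclideanSpace ℝ (Fin d)} {X : Fin K → Ω → Fin (d + 1) → ℕ}
    (h : IsBatchModel p P n ε X) (j : Fin K) {q : ENNReal} (c : Fin d) :
    MemLp (fun ω => ε j ω c) q P := by
  have hm : Measurable fun ω => ε j ω c := by
    have := h.measurable_perturbation j
    fun_prop
  refine MemLp.of_bound hm.aestronglyMeasurable (1 + |p c.castSucc|) ?_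
  filter_upwards [h.cellProb_mem j] with ω hω
  have h1 := hω c.castSucc
  simp only [cellProb, Fin.snoc_castSucc, Set.mem_Icc] at h1
  rw [Real.norm_eq_abs, abs_le]
  constructor <;> linarith [le_abs_self (p c.castSucc), neg_abs_le (p c.castSucc)]

/-- The bounds assumed on `p` omit the last category. Its probability is the mean of the nonnegative
variable `p_C + ε_C`, as `ε_C` is centred too. -/
lemma IsBatchModel.cellProb_last_nonneg {d K : ℕ} {p : Fin (d + 1) → ℝ} {Ω : Type*}
    [MeasurableSpace Ω] {P : Measure Ω} [IsProbabilityMeasure P] {n : Fin K → ℕ}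
    {ε : Fin K → Ω → EuclideanSpace ℝ (Fin d)} {X : Fin K → Ω → Fin (d + 1) → ℕ}
    (h : IsBatchModel p P n ε X) (j : Fin K) : 0 ≤ p (Fin.last d) := by
  have hint : ∀ c, Integrable (fun ω => ε j ω c) P :=
    fun c => memLp_one_iff_integrable.1 (h.memLp_perturbation j c)
  have h1 : ∫ ω, cellProb p (ε j ω) (Fin.last d) ∂P = p (Fin.last d) := by
    simp only [cellProb, Fin.snoc_last]
    simp only [← sub_eq_add_neg]
    rw [integral_sub (integrable_const _) (integrable_finsetSum _ fun c _ => hint c),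
      integral_finsetSum _ fun c _ => hint c]
    simp [h.mean_zero j]
  rw [← h1]
  refine integral_nonneg_of_ae ?_
  filter_upwards [h.cellProb_mem j] with ω hω
  exact (hω _).1

/-! ### Exact conditional characteristic function of the normalized proportions. -/

/-- The normalized vector `√n (p̂ - p)` of the first `C - 1` observed proportions. -/
noncomputable def scaledProportions {d : ℕ} (p : Fin (d + 1) → ℝ) (n : ℕ) (x : Fin (d + 1) → ℕ) :
    EuclideanSpace ℝ (Fin d) :=
  Real.sqrt n • WithLp.toLp 2 fun c => (x c.castSucc : ℝ) / n - p c.castSucc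

/-- The characteristic function of a centred multinomial vector with cell probabilities
`cellProb p e`, at `t / √n`. -/
noncomputable def centredCharFun {d : ℕ} (p : Fin (d + 1) → ℝ) (n : ℕ) (t : Fin d → ℝ)
    (e : EuclideanSpace ℝ (Fin d)) : ℂ :=
  (∑ c, (cellProb p e c : ℂ) * Complex.exp ((((Fin.snoc t 0 : Fin (d + 1) → ℝ) c -
    ∑ c', cellProb p e c' * (Fin.snoc t 0 : Fin (d + 1) → ℝ) c') / Real.sqrt n : ℝ) *
      Complex.I)) ^ n

lemma measurable_centredCharFun {d : ℕ} (p : Fin (d + 1) → ℝ) (n : ℕ) (t : Fin d → ℝ) :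
    Measurable (centredCharFun p n t) := by
  have h : ∀ c, Measurable fun e => cellProb p e c := fun c =>
    (measurable_pi_apply c).comp (measurable_cellProb p)
  unfold centredCharFun
  fun_prop

lemma sum_cellProb_mul_snoc {d : ℕ} (p : Fin (d + 1) → ℝ) (e t : EuclideanSpace ℝ (Fin d)) :
    ∑ c, cellProb p e c * (Fin.snoc t.ofLp 0 : Fin (d + 1) → ℝ) c =
      ∑ c : Fin d, p c.castSucc * t c + inner ℝ e t := by
  rw [sum_snoc_zero_mul]
  simp [cellProb, add_mul, Finset.sum_add_distrib, PiLp.inner_apply, mul_comm]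

/-- Moving the centring from `p` to `p + e` only changes the phase, by the factor `exp(i⟨√n e, t⟩)`.
What remains is the `n`-th power given by the multinomial theorem. -/
lemma sum_multinomialMass_mul_exp_inner {d : ℕ} (p : Fin (d + 1) → ℝ) {n : ℕ} (hn : 0 < n)
    (t e : EuclideanSpace ℝ (Fin d)) :
    ∑ x ∈ Finset.piAntidiag Finset.univ n, (multinomialMass n (cellProb p e) x : ℂ) *
        Complex.exp ((inner ℝ (scaledProportions p n x) t : ℝ) * Complex.I) =
      Complex.exp ((inner ℝ (Real.sqrt n • e) t : ℝ) * Complex.I) *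
        centredCharFun p n t.ofLp e := by
  have hn' : (0 : ℝ) < n := by exact_mod_cast hn
  set r := Real.sqrt n with hr
  have hr0 : 0 < r := Real.sqrt_pos.2 hn'
  have hrr : (n : ℝ) = r * r := (Real.mul_self_sqrt hn'.le).symm
  have hrrC : (n : ℂ) = (r : ℂ) * r := by exact_mod_cast congrArg (fun x : ℝ => (x : ℂ)) hrr
  have hrC : (r : ℂ) ≠ 0 := by exact_mod_cast hr0.ne'
  set s : Fin (d + 1) → ℝ := Fin.snoc t.ofLp 0 with hs
  set b : ℝ := ∑ c : Fin d, p c.castSucc * t c with hb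
  have h1 : ∀ x : Fin (d + 1) → ℕ,
      Complex.exp ((inner ℝ (scaledProportions p n x) t : ℝ) * Complex.I) =
      Complex.exp (-(r * b : ℝ) * Complex.I) *
        ∏ c, Complex.exp ((s c / r : ℝ) * Complex.I) ^ x c := by
    intro x
    have h2 : inner ℝ (scaledProportions p n x) t = -(r * b) + ∑ c, (x c : ℝ) * (s c / r) := by
      have h3 : ∑ c, (x c : ℝ) * (s c / r) = (∑ c : Fin d, (x c.castSucc : ℝ) * t c) / r := by
        rw [← sum_snoc_zero_mul (fun c => (x c : ℝ)), Finset.sum_div]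
        exact Finset.sum_congr rfl fun c _ => by rw [mul_div_assoc]
      rw [h3, scaledProportions, real_inner_smul_left, ← hr, hb]
      simp only [PiLp.inner_apply, RCLike.inner_apply, conj_trivial]
      rw [Finset.mul_sum, Finset.mul_sum, Finset.sum_div, ← Finset.sum_neg_distrib,
        ← Finset.sum_add_distrib]
      refine Finset.sum_congr rfl fun c _ => ?_
      rw [hrr]
      field_simp
      ring
    rw [h2]
    simp only [← Complex.exp_nat_mul]
    rw [← Complex.exp_sum, ← Complex.exp_add]
    congr 1
    push_cast
    rw [add_mul, Finset.sum_mul]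
    simp only [mul_assoc]
  simp only [h1]
  have h4 : ∀ x : Fin (d + 1) → ℕ, (multinomialMass n (cellProb p e) x : ℂ) *
      (Complex.exp (-(r * b : ℝ) * Complex.I) *
        ∏ c, Complex.exp ((s c / r : ℝ) * Complex.I) ^ x c) =
      Complex.exp (-(r * b : ℝ) * Complex.I) * ((multinomialMass n (cellProb p e) x : ℂ) *
        ∏ c, Complex.exp ((s c / r : ℝ) * Complex.I) ^ x c) := fun x => by ring
  simp only [h4]
  rw [← Finset.mul_sum, sum_multinomialMass_mul_prod_pow, centredCharFun,
    sum_cellProb_mul_snoc, ← hb, ← hs, ← hr]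
  set w : ℝ := inner ℝ e t with hw
  have h5 : ∀ c, Complex.exp (((s c - (b + w)) / r : ℝ) * Complex.I) =
      Complex.exp ((s c / r : ℝ) * Complex.I) * Complex.exp (-((b + w) / r : ℝ) * Complex.I) := by
    intro c
    rw [← Complex.exp_add]
    congr 1
    push_cast
    ring
  simp only [h5, ← mul_assoc, ← Finset.sum_mul]
  rw [mul_pow, ← Complex.exp_nat_mul, real_inner_smul_left, ← hw]
  -- Phase bookkeeping with `n / r = r`: the centring `b + w` in each of the `n` trials contributes
  -- `-r (b + w)`.
  have h6 : Complex.exp (-(r * b : ℝ) * Complex.I) =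
      Complex.exp ((r * w : ℝ) * Complex.I) *
        Complex.exp (n * (-((b + w) / r : ℝ) * Complex.I)) := by
    rw [← Complex.exp_add]
    congr 1
    push_cast
    rw [hrrC]
    field_simp
    ring
  rw [h6]
  ring

/-! ### Limit law of the normalized proportions. -/

section Limit

variable {d K : ℕ} {p : Fin (d + 1) → ℝ} {Ω : ℕ → Type*} [∀ m, MeasurableSpace (Ω m)]
  {P : ∀ m, Measure (Ω m)} [∀ m, IsProbabilityMeasure (P m)]
  {n : ℕ → Fin K → ℕ} {ε : ∀ m, Fin K → Ω m → EuclideanSpace ℝ (Fin d)}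
  {X : ∀ m, Fin K → Ω m → Fin (d + 1) → ℕ}

lemma continuous_cellProb (p : Fin (d + 1) → ℝ) (c : Fin (d + 1)) :
    Continuous fun e => cellProb p e c := by
  refine Fin.lastCases ?_ (fun i => ?_) c
  · simp only [cellProb, Fin.snoc_last]
    fun_prop
  · simp only [cellProb, Fin.snoc_castSucc]
    fun_prop

lemma cellProb_zero (p : Fin (d + 1) → ℝ) : cellProb p 0 = p := by
  ext c
  refine Fin.lastCases ?_ (fun i => ?_) c <;> simp [cellProb]

/-- `centredCharFun` is close to a Gaussian characteristic function. -/
lemma norm_centredCharFun_sub_le (hp : ∑ c, p c = 1) (t e : EuclideanSpace ℝ (Fin d))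
    (he : ∀ c, cellProb p e c ∈ Set.Icc (0 : ℝ) 1) {n : ℕ} (hn : 0 < n) :
    ‖centredCharFun p n t.ofLp e -
      Complex.exp (-((∑ c, cellProb p e c * ((Fin.snoc t.ofLp 0 : Fin (d + 1) → ℝ) c -
        ∑ c', cellProb p e c' * (Fin.snoc t.ofLp 0 : Fin (d + 1) → ℝ) c') ^ 2) / 2 : ℝ))‖ ≤
      ((2 * ‖t‖) ^ 3 * Real.exp (2 * ‖t‖) + (2 * ‖t‖) ^ 4 * Real.exp ((2 * ‖t‖) ^ 2)) /
        Real.sqrt n := by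
  have hs : ∀ c, |(Fin.snoc t.ofLp 0 : Fin (d + 1) → ℝ) c| ≤ ‖t‖ := by
    intro c
    refine Fin.lastCases ?_ (fun i => ?_) c
    · simp
    · simpa using PiLp.norm_apply_le t i
  have hq1 := sum_cellProb hp e
  refine norm_sum_mul_exp_pow_sub_exp_le (fun c => (he c).1) hq1 ?_ ?_ hn
  · simp only [mul_sub, Finset.sum_sub_distrib, ← Finset.sum_mul, hq1, one_mul, sub_self]
  · intro c
    have h1 : |∑ c', cellProb p e c' * (Fin.snoc t.ofLp 0 : Fin (d + 1) → ℝ) c'| ≤ ‖t‖ := by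
      calc _ ≤ ∑ c', |cellProb p e c' * (Fin.snoc t.ofLp 0 : Fin (d + 1) → ℝ) c'| :=
            Finset.abs_sum_le_sum_abs _ _
        _ ≤ ∑ c', cellProb p e c' * ‖t‖ := by
            refine Finset.sum_le_sum fun c' _ => ?_
            rw [abs_mul, abs_of_nonneg (he c').1]
            exact mul_le_mul_of_nonneg_left (hs c') (he c').1
        _ = ‖t‖ := by rw [← Finset.sum_mul, hq1, one_mul]
    calc _ ≤ _ := abs_sub _ _
      _ ≤ 2 * ‖t‖ := by linarith [hs c]

/-- If the characteristic functions of `√n ε` converge to that of a centred Gaussian, then those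
of `√n (p̂ - p)` converge to that of a centred Gaussian whose covariance is increased by
`multinomialCov p`. -/
lemma tendsto_charFun_scaledProportions (hp_sum : ∑ c, p c = 1)
    (hp0 : ∀ c, 0 ≤ p c) (hmodel : ∀ m, IsBatchModel p (P m) (n m) (ε m) (X m))
    (j : Fin K) (hn : Tendsto (fun m => n m j) atTop atTop)
    {Ξ : Matrix (Fin d) (Fin d) ℝ} (hΞ : Ξ.PosSemidef)
    (hε : ∀ t, Tendsto (fun m => charFun ((P m).map fun ω => Real.sqrt (n m j) • ε m j ω) t)
      atTop (𝓝 (charFun (multivariateGaussian 0 Ξ) t))) (t : EuclideanSpace ℝ (Fin d)) :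
    Tendsto (fun m => charFun ((P m).map fun ω => scaledProportions p (n m j) (X m j ω)) t)
      atTop (𝓝 (charFun (multivariateGaussian 0 (multinomialCov p + Ξ)) t)) := by
  have hZ : ∀ m, Measurable fun ω => Real.sqrt (n m j) • ε m j ω :=
    fun m => ((hmodel m).measurable_perturbation j).const_smul (Real.sqrt (n m j))
  have hX : ∀ m, Measurable fun ω => scaledProportions p (n m j) (X m j ω) :=
    fun m => (Measurable.of_discrete (f := scaledProportions p (n m j))).comp
      ((hmodel m).measurable_counts j)
  have : ∀ m, IsProbabilityMeasure ((P m).map fun ω => Real.sqrt (n m j) • ε m j ω) :=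
    fun m => Measure.isProbabilityMeasure_map (hZ m).aemeasurable
  -- Pointwise convergence of characteristic functions to a limit continuous at `0` forces
  -- tightness.
  have htight := isTightMeasureSet_of_tendsto_charFun
    (μ := fun m => (P m).map fun ω => Real.sqrt (n m j) • ε m j ω)
    (continuous_charFun.continuousAt) hε
  -- The Gaussian approximation of the noise factor when the perturbation equals `e`; only its
  -- continuity at `0` and its value there matter.
  set g : EuclideanSpace ℝ (Fin d) → ℂ := fun e =>
    Complex.exp (-((∑ c, cellProb p e c * ((Fin.snoc t.ofLp 0 : Fin (d + 1) → ℝ) c -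
        ∑ c', cellProb p e c' * (Fin.snoc t.ofLp 0 : Fin (d + 1) → ℝ) c') ^ 2) / 2 : ℝ)) with hg
  have hgc : Continuous g := by
    have := continuous_cellProb p
    fun_prop
  have hg0 : g 0 = Complex.exp (-((t.ofLp ⬝ᵥ (multinomialCov p).mulVec t.ofLp) / 2 : ℝ)) := by
    rw [dotProduct_multinomialCov hp_sum]
    simp only [hg, cellProb_zero]
  have hlim : charFun (multivariateGaussian 0 (multinomialCov p + Ξ)) t =
      charFun (multivariateGaussian 0 Ξ) t * g 0 := by
    rw [charFun_multivariateGaussian hΞ,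
      charFun_multivariateGaussian ((posSemidef_multinomialCov hp_sum hp0).add hΞ), hg0,
      ← Complex.exp_add, Matrix.add_mulVec, dotProduct_add]
    congr 1
    push_cast
    ring
  rw [hlim]
  have hnpos : ∀ᶠ m in atTop, 0 < n m j := hn.eventually_gt_atTop 0
  have hsqrt : Tendsto (fun m => Real.sqrt (n m j)) atTop atTop :=
    Real.tendsto_sqrt_atTop.comp (tendsto_natCast_atTop_atTop.comp hn)
  have hcle : ∀ m, ∀ᵐ ω ∂P m, ‖centredCharFun p (n m j) t.ofLp (ε m j ω)‖ ≤ 1 := by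
    intro m
    filter_upwards [(hmodel m).cellProb_mem j] with ω hω
    rw [centredCharFun, norm_pow]
    exact pow_le_one₀ (norm_nonneg _)
      (norm_sum_mul_exp_le_one (fun c => (hω c).1) (sum_cellProb hp_sum _) _)
  have hkey : Tendsto (fun m => ∫ ω,
      Complex.exp ((inner ℝ (Real.sqrt (n m j) • ε m j ω) t : ℝ) * Complex.I) *
        (centredCharFun p (n m j) t.ofLp (ε m j ω) - g 0) ∂P m) atTop (𝓝 0) := by
    refine tendsto_integral_zero_of_isTightMeasureSet hZ htight (B := 1 + ‖g 0‖) ?_ ?_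
    · refine Eventually.of_forall fun m => ?_
      filter_upwards [hcle m] with ω hω
      rw [norm_mul, Complex.norm_exp_ofReal_mul_I, one_mul]
      exact (norm_sub_le _ _).trans (by gcongr)
    · intro R δ hδ
      obtain ⟨η, hη, hgη⟩ := Metric.continuousAt_iff.1
        (hgc.continuousAt (x := 0)) (δ / 2) (half_pos hδ)
      -- On `‖√n ε‖ ≤ R` the perturbation is at most `R / √n`, hence inside the continuity radius
      -- `η` of `g`.
      have h1 : ∀ᶠ m in atTop, R / Real.sqrt (n m j) < η :=
        (hsqrt.const_div_atTop R).eventually_lt_const hη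
      have h2 := (hsqrt.const_div_atTop ((2 * ‖t‖) ^ 3 * Real.exp (2 * ‖t‖) +
        (2 * ‖t‖) ^ 4 * Real.exp ((2 * ‖t‖) ^ 2))).eventually_lt_const (half_pos hδ)
      filter_upwards [h1, h2, hnpos] with m h1 h2 h3
      filter_upwards [(hmodel m).cellProb_mem j] with ω hω hR
      have hr0 : 0 < Real.sqrt (n m j) := Real.sqrt_pos.2 (by exact_mod_cast h3)
      rw [norm_mul, Complex.norm_exp_ofReal_mul_I, one_mul]
      have h4 := norm_centredCharFun_sub_le hp_sum t (ε m j ω) hω h3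
      have h5 : ‖ε m j ω‖ < η := by
        rw [norm_smul, Real.norm_eq_abs, abs_of_pos hr0] at hR
        exact lt_of_le_of_lt ((le_div_iff₀' hr0).2 hR) h1
      have h6 : ‖g (ε m j ω) - g 0‖ < δ / 2 := by
        rw [← dist_eq_norm]
        exact hgη (by rwa [dist_zero_right])
      calc _ ≤ ‖centredCharFun p (n m j) t.ofLp (ε m j ω) - g (ε m j ω)‖ +
            ‖g (ε m j ω) - g 0‖ := norm_sub_le_norm_sub_add_norm_sub _ _ _
        _ ≤ δ := by linarith
  have hsum := hkey.add ((hε t).mul_const (g 0))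
  rw [zero_add] at hsum
  refine hsum.congr' ?_
  filter_upwards [hnpos] with m hm
  have hexp : Measurable fun ω =>
      Complex.exp ((inner ℝ (Real.sqrt (n m j) • ε m j ω) t : ℝ) * Complex.I) := by
    have := hZ m
    fun_prop
  have hi1 : Integrable (fun ω =>
      Complex.exp ((inner ℝ (Real.sqrt (n m j) • ε m j ω) t : ℝ) * Complex.I) *
        centredCharFun p (n m j) t.ofLp (ε m j ω)) (P m) := by
    refine Integrable.of_bound (hexp.mul ((measurable_centredCharFun _ _ _).comp
      ((hmodel m).measurable_perturbation j))).aestronglyMeasurable 1 ?_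
    filter_upwards [hcle m] with ω hω
    rwa [norm_mul, Complex.norm_exp_ofReal_mul_I, one_mul]
  have hi2 : Integrable (fun ω =>
      Complex.exp ((inner ℝ (Real.sqrt (n m j) • ε m j ω) t : ℝ) * Complex.I) * g 0) (P m) := by
    refine Integrable.mul_const (Integrable.of_bound hexp.aestronglyMeasurable 1 ?_) _
    exact Eventually.of_forall fun ω => (Complex.norm_exp_ofReal_mul_I _).le
  simp only [mul_sub]
  rw [integral_sub hi1 hi2, integral_mul_const, charFun_apply, charFun_apply,
    integral_map (hZ m).aemeasurable (by fun_prop), integral_map (hX m).aemeasurable (by fun_prop),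
    sub_add_cancel,
    (hmodel m).integral_comp_counts hp_sum j
      (fun x => Complex.exp ((inner ℝ (scaledProportions p (n m j) x) t : ℝ) * Complex.I))]
  simp only [sum_multinomialMass_mul_exp_inner p hm]

end Limit

/-! ### The delta method for the arcsine. -/

/-- Locally uniform delta method for the arcsine transformation. -/
lemma tendstoUniformlyOn_arcsine {q : ℝ} (hq0 : 0 < q) (hq1 : q < 1) (a R : ℝ) {N : ℕ → ℕ}
    (hN : Tendsto N atTop atTop) :
    TendstoUniformlyOn (fun m y => Real.sqrt ((N m : ℝ) + 0.5) *
        (Real.arcsin ((2 * (q + y / Real.sqrt (N m)) - 1) / (1 + 2 * a / N m)) -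
          Real.arcsin (2 * q - 1)))
      (fun y => y / Real.sqrt (q * (1 - q))) atTop (Set.Icc (-R) R) := by
  -- Uniformity in `y` becomes a single limit along a product filter, on which `y` is merely a
  -- bounded function.
  rw [tendstoUniformlyOn_iff_tendsto, tendsto_uniformity_iff_dist_tendsto_zero]
  set l : Filter (ℕ × ℝ) := atTop ×ˢ 𝓟 (Set.Icc (-R) R) with hl
  set u := 2 * q - 1 with hu
  set σ := Real.sqrt (q * (1 - q)) with hσ
  have hq : 0 < q * (1 - q) := mul_pos hq0 (by linarith)
  have hσ0 : 0 < σ := Real.sqrt_pos.2 hq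
  have hσσ : σ ^ 2 = q * (1 - q) := Real.sq_sqrt hq.le
  have hy : ∀ᶠ x in l, x.2 ∈ Set.Icc (-R) R :=
    (tendsto_snd (f := (atTop : Filter ℕ))).eventually (eventually_principal.2 fun _ h => h)
  have hNl : Tendsto (fun x : ℕ × ℝ => (N x.1 : ℝ)) l atTop :=
    tendsto_natCast_atTop_atTop.comp (hN.comp tendsto_fst)
  have hr : Tendsto (fun x : ℕ × ℝ => Real.sqrt (N x.1)) l atTop := Real.tendsto_sqrt_atTop.comp hNl
  have hi : Tendsto (fun x : ℕ × ℝ => (Real.sqrt (N x.1))⁻¹) l (𝓝 0) := hr.inv_tendsto_atTop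
  have hybdd : IsBoundedUnder (· ≤ ·) l (norm ∘ fun x : ℕ × ℝ => x.2) := by
    refine isBoundedUnder_of_eventually_le (a := R) ?_
    filter_upwards [hy] with x hx
    exact abs_le.2 hx
  have hyi : Tendsto (fun x : ℕ × ℝ => (Real.sqrt (N x.1))⁻¹ * x.2) l (𝓝 0) :=
    hi.zero_mul_isBoundedUnder_le hybdd
  set h : ℕ × ℝ → ℝ := fun x => (2 * (q + (Real.sqrt (N x.1))⁻¹ * x.2) - 1) /
    (1 + 2 * a * ((Real.sqrt (N x.1))⁻¹ ^ 2)) with hh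
  have hden : Tendsto (fun x : ℕ × ℝ => 1 + 2 * a * ((Real.sqrt (N x.1))⁻¹ ^ 2)) l (𝓝 1) := by
    simpa using ((hi.pow 2).const_mul (2 * a)).const_add 1
  have hhu : Tendsto h l (𝓝 u) := by
    have := (((hyi.const_add q).const_mul 2).sub_const 1).div hden one_ne_zero
    rwa [add_zero, div_one] at this
  have hderiv : deriv Real.arcsin u = 1 / (2 * σ) := by
    rw [Real.deriv_arcsin]
    have : 1 - u ^ 2 = (2 * σ) ^ 2 := by rw [mul_pow, hσσ, hu]; ring
    simp only [this, Real.sqrt_sq (by positivity : 0 ≤ 2 * σ)]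
  -- `dslope` is the difference quotient completed by the derivative, so the factorization of
  -- `arcsin (h x) - arcsin u` also holds where `h x = u`.
  have hslope : Tendsto (fun x => dslope Real.arcsin u (h x)) l (𝓝 (1 / (2 * σ))) := by
    have h1 : ContinuousAt (dslope Real.arcsin u) u := by
      rw [continuousAt_dslope_same]
      exact Real.differentiableAt_arcsin.2 ⟨by linarith, by linarith⟩
    rw [← hderiv, ← dslope_same Real.arcsin u]
    exact h1.tendsto.comp hhu
  have hκ : Tendsto (fun x : ℕ × ℝ => Real.sqrt (1 + 0.5 * (Real.sqrt (N x.1))⁻¹ ^ 2)) l (𝓝 1) := by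
    have := ((hi.pow 2).const_mul 0.5).const_add 1
    simpa using this.sqrt
  have hA : Tendsto (fun x : ℕ × ℝ => Real.sqrt (1 + 0.5 * (Real.sqrt (N x.1))⁻¹ ^ 2) *
      dslope Real.arcsin u (h x) / (1 + 2 * a * ((Real.sqrt (N x.1))⁻¹ ^ 2))) l
      (𝓝 (1 / (2 * σ))) := by
    have := (hκ.mul hslope).div hden one_ne_zero
    rwa [one_mul, div_one] at this
  have hA0 := (hA.sub_const (1 / (2 * σ))).const_mul 2
  rw [sub_self, mul_zero] at hA0
  -- The exact error is `2 (A - 1/(2σ)) y - 2au A / √N`, with `A` the quantity of `hA`: a vanishing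
  -- factor times bounded `y`, and the bias due to `a`.
  have hmain := (hA0.zero_mul_isBoundedUnder_le hybdd).sub ((hA.mul hi).const_mul (2 * a * u))
  simp only [mul_zero, sub_zero] at hmain
  have habs := hmain.abs
  rw [abs_zero] at habs
  refine habs.congr' ?_
  filter_upwards [hNl.eventually_gt_atTop 0, hden.eventually_ne one_ne_zero] with x hx hd
  rw [dist_comm, Real.dist_eq]
  congr 1
  set r := Real.sqrt (N x.1) with hr'
  have hr0 : 0 < r := Real.sqrt_pos.2 hx
  have hrr : (N x.1 : ℝ) = r ^ 2 := (Real.sq_sqrt hx.le).symm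
  have e1 : Real.sqrt ((N x.1 : ℝ) + 0.5) = r * Real.sqrt (1 + 0.5 * r⁻¹ ^ 2) := by
    rw [hr', ← Real.sqrt_mul hx.le, ← hr', hrr]
    congr 1
    field_simp
  have e2 : (2 * (q + x.2 / r) - 1) / (1 + 2 * a / N x.1) = h x := by
    simp only [hh, ← hr']
    rw [hrr]
    congr 1
    · ring
    · ring
  have e3 : Real.arcsin (h x) - Real.arcsin u = (h x - u) * dslope Real.arcsin u (h x) := by
    rw [← smul_eq_mul, sub_smul_dslope]
  have e4 : r * (h x - u) = (2 * x.2 - 2 * a * u * r⁻¹) / (1 + 2 * a * r⁻¹ ^ 2) := by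
    simp only [hh, ← hr']
    rw [eq_div_iff hd, mul_assoc, sub_mul, div_mul_cancel₀ _ hd, hu]
    field_simp
    ring
  rw [e1, e2, e3]
  rw [show r * Real.sqrt (1 + 0.5 * r⁻¹ ^ 2) * ((h x - u) * dslope Real.arcsin u (h x)) =
    Real.sqrt (1 + 0.5 * r⁻¹ ^ 2) * dslope Real.arcsin u (h x) * (r * (h x - u)) by ring, e4]
  field_simp
  ring

/-! ### From uniform convergence of densities to characteristic functions. -/

/-- A form of Scheffé's lemma: if probability densities converge pointwise to a probability
density, then so do the integrals of bounded functions. -/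
lemma tendsto_integral_mul_of_tendsto_density {α : Type*} [MeasurableSpace α] {μ : Measure α}
    {f : ℕ → α → ℝ} {g : α → ℝ} (hf : ∀ᶠ m in atTop, Integrable (f m) μ ∧ ∫ x, f m x ∂μ = 1)
    (hf0 : ∀ m x, 0 ≤ f m x) (hg : Integrable g μ) (hg1 : ∫ x, g x ∂μ = 1)
    (hlim : ∀ x, Tendsto (fun m => f m x) atTop (𝓝 (g x))) {h : α → ℂ} (hm : Measurable h)
    (hh : ∀ x, ‖h x‖ ≤ 1) :
    Tendsto (fun m => ∫ x, (f m x : ℂ) * h x ∂μ) atTop (𝓝 (∫ x, (g x : ℂ) * h x ∂μ)) := by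
  have hg0 : ∀ x, 0 ≤ g x := fun x => ge_of_tendsto' (hlim x) fun m => hf0 m x
  -- The positive part of `g - f m` is dominated by `g`. It suffices because `|f - g| = (f - g) + 2
  -- (g - f)⁺` and `f - g` integrates to zero.
  have h1 : Tendsto (fun m => ∫ x, max (g x - f m x) 0 ∂μ) atTop (𝓝 (∫ _, (0 : ℝ) ∂μ)) := by
    refine tendsto_integral_filter_of_dominated_convergence g ?_ ?_ hg ?_
    · filter_upwards [hf] with m hfm
      exact ((hg.sub hfm.1).pos_part).aestronglyMeasurable
    · refine Eventually.of_forall fun m => Eventually.of_forall fun x => ?_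
      rw [Real.norm_eq_abs, abs_of_nonneg (le_max_right _ _)]
      exact max_le (by linarith [hf0 m x]) (hg0 x)
    · refine Eventually.of_forall fun x => ?_
      have := ((hlim x).const_sub (g x)).max (tendsto_const_nhds (x := (0 : ℝ)))
      simpa using this
  rw [integral_zero] at h1
  rw [tendsto_iff_norm_sub_tendsto_zero]
  refine squeeze_zero' (g := fun m => 2 * ∫ x, max (g x - f m x) 0 ∂μ)
    (Eventually.of_forall fun m => norm_nonneg _) ?_ (by simpa using h1.const_mul 2)
  filter_upwards [hf] with m hfm
  have hint : ∀ φ : α → ℝ, Integrable φ μ → Integrable (fun x => (φ x : ℂ) * h x) μ := by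
    intro φ hφ
    refine (hφ.norm).mono' (hφ.ofReal.aestronglyMeasurable.mul hm.aestronglyMeasurable) ?_
    refine Eventually.of_forall fun x => ?_
    rw [norm_mul, Complex.norm_real]
    exact mul_le_of_le_one_right (norm_nonneg _) (hh x)
  have hpos : Integrable (fun x => max (g x - f m x) 0) μ := (hg.sub hfm.1).pos_part
  have hdiff : Integrable (fun x => f m x - g x) μ := hfm.1.sub hg
  rw [← integral_sub (hint _ hfm.1) (hint _ hg)]
  calc _ ≤ ∫ x, ((f m x - g x) + 2 * max (g x - f m x) 0) ∂μ := by
        refine norm_integral_le_of_norm_le (hdiff.add (hpos.const_mul 2)) ?_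
        refine Eventually.of_forall fun x => ?_
        rw [← sub_mul, norm_mul, ← Complex.ofReal_sub, Complex.norm_real, Real.norm_eq_abs]
        refine (mul_le_of_le_one_right (abs_nonneg _) (hh x)).trans ?_
        rcases le_total (g x) (f m x) with h' | h'
        · rw [abs_of_nonneg (by linarith), max_eq_right (by linarith)]
          linarith
        · rw [abs_of_nonpos (by linarith), max_eq_left (by linarith)]
          linarith
    _ = _ := by
        rw [integral_add hdiff (hpos.const_mul 2), integral_sub hfm.1 hg, hfm.2, hg1,
          integral_const_mul]
        ring

open scoped MatrixOrder in
/-- The Fourier transform of the Gaussian density. -/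
lemma integral_gaussianDensity_mul_exp {d : ℕ} {S : Matrix (Fin d) (Fin d) ℝ} (hS : S.PosDef)
    (t : EuclideanSpace ℝ (Fin d)) :
    ∫ x, (gaussianDensity S x : ℂ) * Complex.exp ((inner ℝ x t : ℝ) * Complex.I) =
      charFun (multivariateGaussian 0 S) t := by
  -- The substitution `x = B y` with the symmetric square root `B` turns the quadratic form of `S⁻¹`
  -- into `‖y‖²`; its Jacobian `det B = √(det S)` cancels the normalizing constant.
  set B := CFC.sqrt S with hB
  have hBB : B * B = S := CFC.sqrt_mul_sqrt_self S hS.posSemidef.nonneg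
  have hBs : B.transpose = B := by
    have h := (CFC.sqrt_nonneg S).isSelfAdjoint
    rw [IsSelfAdjoint, Matrix.star_eq_conjTranspose] at h
    rwa [Matrix.conjTranspose_eq_transpose_of_trivial] at h
  have hdet : B.det = Real.sqrt S.det := by
    simpa using Matrix.PosSemidef.det_sqrt hS.posSemidef
  have hdS : 0 < S.det := hS.det_pos
  have hdB : 0 < B.det := by rw [hdet]; exact Real.sqrt_pos.2 hdS
  have hBu : IsUnit B.det := hdB.ne'.isUnit
  have hBSB : B * (S⁻¹ * B) = 1 := by
    rw [← hBB, Matrix.mul_inv_rev, Matrix.mul_assoc, Matrix.nonsing_inv_mul _ hBu, Matrix.mul_one,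
      Matrix.mul_nonsing_inv _ hBu]
  set T := Matrix.toEuclideanCLM (𝕜 := ℝ) B with hT
  have hTdet : LinearMap.det (T : EuclideanSpace ℝ (Fin d) →ₗ[ℝ] EuclideanSpace ℝ (Fin d)) =
      B.det := by
    have : (T : EuclideanSpace ℝ (Fin d) →ₗ[ℝ] EuclideanSpace ℝ (Fin d)) =
        Matrix.toLin (PiLp.basisFun 2 ℝ (Fin d)) (PiLp.basisFun 2 ℝ (Fin d)) B := by
      rw [← Matrix.toLpLin_eq_toLin]
      rfl
    rw [this, LinearMap.det_toLin]
  have hTx : ∀ x : EuclideanSpace ℝ (Fin d), (T x).ofLp = B.mulVec x.ofLp :=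
    fun x => Matrix.ofLp_toEuclideanCLM B x
  have hinner : ∀ x y : EuclideanSpace ℝ (Fin d), inner ℝ x y = x.ofLp ⬝ᵥ y.ofLp := by
    intro x y
    simp [PiLp.inner_apply, dotProduct, mul_comm]
  have hsymm : ∀ x y : Fin d → ℝ, B.mulVec x ⬝ᵥ y = x ⬝ᵥ B.mulVec y := by
    intro x y
    rw [Matrix.dotProduct_mulVec, ← Matrix.mulVec_transpose, hBs]
  set F : EuclideanSpace ℝ (Fin d) → ℂ := fun x =>
    (gaussianDensity S x : ℂ) * Complex.exp ((inner ℝ x t : ℝ) * Complex.I) with hF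
  have hFc : Continuous F := by
    have : Continuous (gaussianDensity S) := by
      unfold gaussianDensity
      simp only [dotProduct, Matrix.mulVec]
      fun_prop
    fun_prop
  set c : ℝ := (Real.sqrt ((2 * Real.pi) ^ d * S.det))⁻¹ with hc
  have hFT : ∀ y, F (T y) = c * Complex.exp (-(1 / 2 : ℂ) * ‖y‖ ^ 2 +
      Complex.I * (inner ℝ (T t) y : ℝ)) := by
    intro y
    have h1 : (T y).ofLp ⬝ᵥ S⁻¹.mulVec (T y).ofLp = ‖y‖ ^ 2 := by
      rw [hTx, hsymm, Matrix.mulVec_mulVec, Matrix.mulVec_mulVec,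
        Matrix.mul_assoc, hBSB, Matrix.one_mulVec,
        ← hinner, real_inner_self_eq_norm_sq]
    have h2 : inner ℝ (T y) t = inner ℝ (T t) y := by
      rw [hinner, hinner, hTx, hTx, hsymm, dotProduct_comm]
    simp only [hF, gaussianDensity, h1, h2, ← hc]
    push_cast
    rw [mul_assoc, ← Complex.exp_add]
    congr 2
    ring
  have hmap := Measure.map_linearMap_addHaar_eq_smul_addHaar
    (volume : Measure (EuclideanSpace ℝ (Fin d))) (f := (T : _ →ₗ[ℝ] _)) (by
      rw [hTdet]; exact hdB.ne')
  have hint : ∫ y, F (T y) = (B.det)⁻¹ • ∫ x, F x := by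
    have h1 : ∫ y, F (T y) = ∫ x, F x ∂(Measure.map T volume) :=
      (integral_map T.continuous.aemeasurable hFc.aestronglyMeasurable).symm
    rw [h1]
    have h2 : Measure.map T (volume : Measure (EuclideanSpace ℝ (Fin d))) =
        ENNReal.ofReal |(B.det)⁻¹| • volume := by
      rw [← hTdet]; exact hmap
    rw [h2, integral_smul_measure, ENNReal.toReal_ofReal (abs_nonneg _),
      abs_of_pos (inv_pos.2 hdB)]
  have hval : ∫ x, F x = B.det • ∫ y, F (T y) := by
    rw [hint, smul_smul, mul_inv_cancel₀ hdB.ne', one_smul]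
  rw [hval]
  simp only [hFT]
  rw [integral_const_mul, GaussianFourier.integral_cexp_neg_mul_sq_norm_add (by norm_num),
    charFun_multivariateGaussian hS.posSemidef]
  have hnorm : ‖T t‖ ^ 2 = t.ofLp ⬝ᵥ S.mulVec t.ofLp := by
    rw [← real_inner_self_eq_norm_sq, hinner, hTx, hsymm, Matrix.mulVec_mulVec, hBB]
  have hpi : ((Real.pi : ℂ) / (1 / 2)) ^ (Module.finrank ℝ (EuclideanSpace ℝ (Fin d)) / 2 : ℂ) =
      (Real.sqrt ((2 * Real.pi) ^ d) : ℝ) := by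
    rw [finrank_euclideanSpace_fin, Real.sqrt_eq_rpow, ← Real.rpow_natCast, ← Real.rpow_mul
      (by positivity), Complex.ofReal_cpow (by positivity)]
    congr 1
    · push_cast; ring
    · push_cast; ring
  have hcc : B.det * c * Real.sqrt ((2 * Real.pi) ^ d) = 1 := by
    rw [hc, hdet, Real.sqrt_mul (by positivity)]
    have h1 : 0 < Real.sqrt S.det := Real.sqrt_pos.2 hdS
    have h2 : 0 < Real.sqrt ((2 * Real.pi) ^ d) := Real.sqrt_pos.2 (by positivity)
    field_simp
  rw [hpi, Complex.real_smul, ← mul_assoc, ← mul_assoc, ← Complex.ofReal_mul, ← Complex.ofReal_mul,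
    hcc, Complex.ofReal_one, one_mul]
  congr 1
  rw [← Complex.ofReal_pow, hnorm, Complex.I_sq]
  simp
  ring

lemma integral_gaussianDensity {d : ℕ} {S : Matrix (Fin d) (Fin d) ℝ} (hS : S.PosDef) :
    ∫ x, gaussianDensity S x = 1 := by
  have h := integral_gaussianDensity_mul_exp hS 0
  simp only [inner_zero_right, Complex.ofReal_zero, zero_mul, Complex.exp_zero, mul_one,
    integral_complex_ofReal, charFun_zero, probReal_univ] at h
  exact_mod_cast h

/-- A non-integrable function has integral `0` by convention, whereas this integral is `1`. -/
lemma integrable_gaussianDensity {d : ℕ} {S : Matrix (Fin d) (Fin d) ℝ} (hS : S.PosDef) :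
    Integrable (gaussianDensity S) := by
  by_contra h
  have := integral_gaussianDensity hS
  rw [integral_undef h] at this
  exact zero_ne_one this

/-- Uniform convergence of densities to a Gaussian density implies convergence of the
characteristic functions. -/
lemma ScaledDensityTendsto.tendsto_charFun {d : ℕ} {Ω : ℕ → Type*} [∀ m, MeasurableSpace (Ω m)]
    {P : ∀ m, Measure (Ω m)} [∀ m, IsProbabilityMeasure (P m)] {n : ℕ → ℕ}
    {ε : ∀ m, Ω m → EuclideanSpace ℝ (Fin d)} (hε : ∀ m, Measurable (ε m))
    {S : Matrix (Fin d) (Fin d) ℝ} (hS : S.PosDef) (h : ScaledDensityTendsto P n ε S)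
    (t : EuclideanSpace ℝ (Fin d)) :
    Tendsto (fun m => charFun ((P m).map fun ω => Real.sqrt (n m) • ε m ω) t) atTop
      (𝓝 (charFun (multivariateGaussian 0 S) t)) := by
  obtain ⟨f, hfm, hf0, hdens, hunif⟩ := h
  rw [← integral_gaussianDensity_mul_exp hS]
  have hfint : ∀ᶠ m in atTop, Integrable (f m) ∧ ∫ x, f m x = 1 := by
    filter_upwards [hdens] with m hm
    have hprob : IsProbabilityMeasure ((P m).map fun ω => Real.sqrt (n m) • ε m ω) :=
      Measure.isProbabilityMeasure_map ((hε m).const_smul (Real.sqrt (n m))).aemeasurable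
    have h1 : ∫⁻ x, ENNReal.ofReal (f m x) = 1 := by
      rw [← setLIntegral_univ, ← withDensity_apply _ MeasurableSet.univ, ← hm, measure_univ]
    refine ⟨⟨(hfm m).aestronglyMeasurable, ?_⟩, ?_⟩
    · rw [hasFiniteIntegral_iff_ofReal (Eventually.of_forall (hf0 m)), h1]
      exact ENNReal.one_lt_top
    · rw [integral_eq_lintegral_of_nonneg_ae (Eventually.of_forall (hf0 m))
        (hfm m).aestronglyMeasurable, h1, ENNReal.toReal_one]
  refine (tendsto_integral_mul_of_tendsto_density hfint hf0 (integrable_gaussianDensity hS)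
    (integral_gaussianDensity hS) (fun x => hunif.tendsto_at x)
    (h := fun x => Complex.exp ((inner ℝ x t : ℝ) * Complex.I)) (by fun_prop)
    fun x => (Complex.norm_exp_ofReal_mul_I _).le).congr' ?_
  filter_upwards [hdens] with m hm
  rw [hm, charFun_apply, integral_withDensity_eq_integral_toReal_smul (hfm m).ennreal_ofReal
    (Eventually.of_forall fun x => ENNReal.ofReal_lt_top)]
  simp only [ENNReal.toReal_ofReal (hf0 m _), Complex.real_smul]

/-! ### The limiting covariance matrix. -/

/-- The matrix is `D (Ξ_p + Ξ) D` with `D` the diagonal Jacobian of the transform, so `D` can be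
moved onto `t`. -/
lemma dotProduct_arcsineLimitCov {d : ℕ} (p : Fin (d + 1) → ℝ) (Ξ : Matrix (Fin d) (Fin d) ℝ)
    (t : Fin d → ℝ) :
    t ⬝ᵥ (arcsineLimitCov p Ξ).mulVec t =
      (fun c => t c / Real.sqrt (p c.castSucc * (1 - p c.castSucc))) ⬝ᵥ
        (multinomialCov p + Ξ).mulVec
          (fun c => t c / Real.sqrt (p c.castSucc * (1 - p c.castSucc))) := by
  simp only [dotProduct, Matrix.mulVec, Finset.mul_sum, arcsineLimitCov, Matrix.of_apply]
  refine Finset.sum_congr rfl fun c _ => Finset.sum_congr rfl fun c' _ => ?_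
  ring

lemma posSemidef_arcsineLimitCov {d : ℕ} {p : Fin (d + 1) → ℝ} (hp : ∑ c, p c = 1)
    (hp0 : ∀ c, 0 ≤ p c) {Ξ : Matrix (Fin d) (Fin d) ℝ} (hΞ : Ξ.PosSemidef) :
    (arcsineLimitCov p Ξ).PosSemidef := by
  have h := (posSemidef_multinomialCov hp hp0).add hΞ
  refine Matrix.PosSemidef.of_dotProduct_mulVec_nonneg ?_ fun t => ?_
  · ext c c'
    have h1 := h.isHermitian.apply c c'
    rw [star_trivial] at h1
    simp only [Matrix.conjTranspose_apply, star_trivial, arcsineLimitCov, Matrix.of_apply, h1]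
    rw [mul_comm (Real.sqrt _)]
  · rw [star_trivial, dotProduct_arcsineLimitCov]
    simpa using h.dotProduct_mulVec_nonneg
      (fun c => t c / Real.sqrt (p c.castSucc * (1 - p c.castSucc)))

lemma arcsineLimitCov_zero_self {d : ℕ} {p : Fin (d + 1) → ℝ} {c : Fin d}
    (hc : 0 < p c.castSucc ∧ p c.castSucc < 1) : arcsineLimitCov p 0 c c = 1 := by
  have h : 0 < p c.castSucc * (1 - p c.castSucc) := mul_pos hc.1 (by linarith [hc.2])
  simp only [arcsineLimitCov, multinomialCov, add_zero, Matrix.of_apply, if_true]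
  rw [Real.mul_self_sqrt h.le, div_self h.ne']

lemma arcsineLimitCov_zero_of_ne {d : ℕ} {p : Fin (d + 1) → ℝ} {c c' : Fin d}
    (hc : 0 < p c.castSucc ∧ p c.castSucc < 1) (hc' : 0 < p c'.castSucc ∧ p c'.castSucc < 1)
    (hne : c ≠ c') :
    arcsineLimitCov p 0 c c' =
      -Real.sqrt (p c.castSucc * p c'.castSucc / ((1 - p c.castSucc) * (1 - p c'.castSucc))) := by
  simp only [arcsineLimitCov, multinomialCov, add_zero, Matrix.of_apply, hne, if_false]
  set x := p c.castSucc
  set y := p c'.castSucc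
  have hx : 0 < 1 - x := by linarith [hc.2]
  have hy : 0 < 1 - y := by linarith [hc'.2]
  obtain ⟨hx0, -⟩ := hc
  obtain ⟨hy0, -⟩ := hc'
  rw [neg_div, ← Real.sqrt_mul (mul_pos hx0 hx).le]
  congr 1
  symm
  rw [Real.sqrt_eq_iff_mul_self_eq (by positivity) (by positivity), div_mul_div_comm,
    Real.mul_self_sqrt (by positivity)]
  field_simp

/-! ### The limit theorem for the arcsine transform, and negligible perturbations. -/

section Limit

variable {d K : ℕ} {p : Fin (d + 1) → ℝ} {Ω : ℕ → Type*} [∀ m, MeasurableSpace (Ω m)]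
  {P : ∀ m, Measure (Ω m)} [∀ m, IsProbabilityMeasure (P m)]
  {n : ℕ → Fin K → ℕ} {ε : ∀ m, Fin K → Ω m → EuclideanSpace ℝ (Fin d)}
  {X : ∀ m, Fin K → Ω m → Fin (d + 1) → ℕ}

/-- The arcsine transform is asymptotically linear in the normalized proportions. -/
lemma eventually_norm_arcsineTransform_sub_le (hp : ∀ c : Fin d, 0 < p c.castSucc ∧ p c.castSucc < 1)
    (a : ℝ) {N : ℕ → ℕ} (hN : Tendsto N atTop atTop) (R : ℝ) {δ : ℝ} (hδ : 0 < δ) :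
    ∀ᶠ m in atTop, ∀ x : Fin (d + 1) → ℕ, ‖scaledProportions p (N m) x‖ ≤ R → ∀ c : Fin d,
      |(Real.sqrt ((N m : ℝ) + 0.5) • (arcsineTransform a (N m) x - arcsineCentre p)) c -
        scaledProportions p (N m) x c / Real.sqrt (p c.castSucc * (1 - p c.castSucc))| ≤ δ := by
  have h1 : ∀ᶠ m in atTop, ∀ c : Fin d, ∀ y ∈ Set.Icc (-R) R,
      dist (y / Real.sqrt (p c.castSucc * (1 - p c.castSucc)))
        (Real.sqrt ((N m : ℝ) + 0.5) *
        (Real.arcsin ((2 * (p c.castSucc + y / Real.sqrt (N m)) - 1) / (1 + 2 * a / N m)) -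
          Real.arcsin (2 * p c.castSucc - 1))) < δ :=
    eventually_all.2 fun c => Metric.tendstoUniformlyOn_iff.1
      (tendstoUniformlyOn_arcsine (hp c).1 (hp c).2 a R hN) δ hδ
  filter_upwards [h1, hN.eventually_gt_atTop 0] with m hm hNm x hx c
  have hr : 0 < Real.sqrt (N m) := Real.sqrt_pos.2 (by exact_mod_cast hNm)
  have h2 : |scaledProportions p (N m) x c| ≤ R :=
    (PiLp.norm_apply_le (scaledProportions p (N m) x) c).trans hx
  have h3 := hm c _ (abs_le.1 h2)
  have h4 : p c.castSucc + scaledProportions p (N m) x c / Real.sqrt (N m) =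
      (x c.castSucc : ℝ) / N m := by
    simp only [scaledProportions, PiLp.smul_apply, smul_eq_mul]
    field_simp
    ring
  rw [h4, dist_comm, Real.dist_eq] at h3
  simpa [arcsineTransform, arcsineCentre] using h3.le

/-- The limit theorem under convergence of the characteristic functions of `√n ε`. -/
theorem tendstoInDistribution_arcsineTransform (hp_sum : ∑ c, p c = 1)
    (hp : ∀ c : Fin d, 0 < p c.castSucc ∧ p c.castSucc < 1) (hp0 : ∀ c, 0 ≤ p c) (a : ℝ)
    (hmodel : ∀ m, IsBatchModel p (P m) (n m) (ε m) (X m))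
    (j : Fin K) (hn : Tendsto (fun m => n m j) atTop atTop)
    {Ξ : Matrix (Fin d) (Fin d) ℝ} (hΞ : Ξ.PosSemidef)
    (hε : ∀ t, Tendsto (fun m => charFun ((P m).map fun ω => Real.sqrt (n m j) • ε m j ω) t)
      atTop (𝓝 (charFun (multivariateGaussian 0 Ξ) t))) :
    TendstoInDistribution
      (fun m ω => Real.sqrt ((n m j : ℝ) + 0.5) •
        (arcsineTransform a (n m j) (X m j ω) - arcsineCentre p))
      atTop id P (multivariateGaussian 0 (arcsineLimitCov p Ξ)) := by
  have hY := tendsto_charFun_scaledProportions hp_sum hp0 hmodel j hn hΞ hε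
  have hYm : ∀ m, Measurable fun ω => scaledProportions p (n m j) (X m j ω) :=
    fun m => (Measurable.of_discrete (f := scaledProportions p (n m j))).comp
      ((hmodel m).measurable_counts j)
  have hWm : ∀ m, Measurable fun ω => Real.sqrt ((n m j : ℝ) + 0.5) •
      (arcsineTransform a (n m j) (X m j ω) - arcsineCentre p) :=
    fun m => (Measurable.of_discrete (f := fun x => Real.sqrt ((n m j : ℝ) + 0.5) •
      (arcsineTransform a (n m j) x - arcsineCentre p))).comp ((hmodel m).measurable_counts j)
  have : ∀ m, IsProbabilityMeasure ((P m).map fun ω => scaledProportions p (n m j) (X m j ω)) :=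
    fun m => Measure.isProbabilityMeasure_map (hYm m).aemeasurable
  have htight := isTightMeasureSet_of_tendsto_charFun
    (μ := fun m => (P m).map fun ω => scaledProportions p (n m j) (X m j ω))
    (continuous_charFun.continuousAt) hY
  refine ⟨fun m => (hWm m).aemeasurable, aemeasurable_id, ?_⟩
  refine ProbabilityMeasure.tendsto_of_tendsto_charFun fun t => ?_
  simp only [ProbabilityMeasure.coe_mk, Measure.map_id]
  -- Testing the transformed vector against `t` is asymptotically testing the normalized proportions
  -- against `t'`.
  set t' : EuclideanSpace ℝ (Fin d) :=
    WithLp.toLp 2 fun c => t c / Real.sqrt (p c.castSucc * (1 - p c.castSucc)) with ht'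
  have hlim : charFun (multivariateGaussian 0 (arcsineLimitCov p Ξ)) t =
      charFun (multivariateGaussian 0 (multinomialCov p + Ξ)) t' := by
    rw [charFun_multivariateGaussian (posSemidef_arcsineLimitCov hp_sum hp0 hΞ),
      charFun_multivariateGaussian ((posSemidef_multinomialCov hp_sum hp0).add hΞ),
      dotProduct_arcsineLimitCov, inner_zero_right, inner_zero_right]
  rw [hlim]
  have hdiff : Tendsto (fun m => ∫ ω,
      (Complex.exp ((inner ℝ (Real.sqrt ((n m j : ℝ) + 0.5) •
        (arcsineTransform a (n m j) (X m j ω) - arcsineCentre p)) t : ℝ) * Complex.I) -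
      Complex.exp ((inner ℝ (scaledProportions p (n m j) (X m j ω)) t' : ℝ) * Complex.I)) ∂P m)
      atTop (𝓝 0) := by
    refine tendsto_integral_zero_of_isTightMeasureSet hYm htight (B := 2) ?_ ?_
    · refine Eventually.of_forall fun m => Eventually.of_forall fun ω => ?_
      refine (norm_sub_le _ _).trans ?_
      rw [Complex.norm_exp_ofReal_mul_I, Complex.norm_exp_ofReal_mul_I]
      norm_num
    · intro R δ hδ
      set T : ℝ := ∑ c : Fin d, |t c| with hT
      have hT0 : 0 ≤ T := Finset.sum_nonneg fun c _ => abs_nonneg _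
      -- The coordinatewise errors are weighted by `|t c|`, of total `T`; the `+ 1` covers `T = 0`.
      filter_upwards [eventually_norm_arcsineTransform_sub_le hp a hn R
        (show 0 < δ / (T + 1) by positivity)] with m hm
      refine Eventually.of_forall fun ω hω => ?_
      refine (norm_exp_ofReal_mul_I_sub_exp_le _ _).trans ?_
      have h1 := hm (X m j ω) hω
      set W := Real.sqrt ((n m j : ℝ) + 0.5) •
        (arcsineTransform a (n m j) (X m j ω) - arcsineCentre p)
      set Y := scaledProportions p (n m j) (X m j ω)
      have h2 : inner ℝ W t - inner ℝ Y t' =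
          ∑ c : Fin d, t c * (W c - Y c / Real.sqrt (p c.castSucc * (1 - p c.castSucc))) := by
        simp only [PiLp.inner_apply, RCLike.inner_apply, conj_trivial, ht']
        rw [← Finset.sum_sub_distrib]
        exact Finset.sum_congr rfl fun c _ => by ring
      rw [h2]
      calc _ ≤ ∑ c : Fin d, |t c * (W c - Y c / Real.sqrt (p c.castSucc * (1 - p c.castSucc)))| :=
            Finset.abs_sum_le_sum_abs _ _
        _ ≤ ∑ c : Fin d, |t c| * (δ / (T + 1)) := by
            refine Finset.sum_le_sum fun c _ => ?_
            rw [abs_mul]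
            exact mul_le_mul_of_nonneg_left (h1 c) (abs_nonneg _)
        _ = T * (δ / (T + 1)) := by rw [← Finset.sum_mul]
        _ ≤ δ := by
            rw [← mul_div_assoc, div_le_iff₀ (by positivity)]
            nlinarith
  have hsum := hdiff.add (hY t')
  rw [zero_add] at hsum
  refine hsum.congr fun m => ?_
  have hint : ∀ {V : Ω m → EuclideanSpace ℝ (Fin d)} (_ : Measurable V)
      (s : EuclideanSpace ℝ (Fin d)),
      Integrable (fun ω => Complex.exp ((inner ℝ (V ω) s : ℝ) * Complex.I)) (P m) :=
    fun hV s => Integrable.of_bound (by fun_prop) 1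
      (Eventually.of_forall fun ω => (Complex.norm_exp_ofReal_mul_I _).le)
  rw [integral_sub (hint (hWm m) t) (hint (hYm m) t'), charFun_apply, charFun_apply,
    integral_map (hWm m).aemeasurable (by fun_prop), integral_map (hYm m).aemeasurable
      (by fun_prop), sub_add_cancel]

lemma IsBatchModel.integral_inner_sq {Ω : Type*} [MeasurableSpace Ω] {P : Measure Ω}
    [IsProbabilityMeasure P] {n : Fin K → ℕ} {ε : Fin K → Ω → EuclideanSpace ℝ (Fin d)}
    {X : Fin K → Ω → Fin (d + 1) → ℕ} (h : IsBatchModel p P n ε X) (j : Fin K)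
    (t : EuclideanSpace ℝ (Fin d)) :
    ∫ ω, (inner ℝ (ε j ω) t) ^ 2 ∂P =
      ∑ c, ∑ c', t c * t c' * cov[fun ω => ε j ω c, fun ω => ε j ω c'; P] := by
  have hL : ∀ c, MemLp (fun ω => ε j ω c) 2 P := fun c => h.memLp_perturbation j c
  have h1 : ∀ ω, (inner ℝ (ε j ω) t) ^ 2 = ∑ c, ∑ c', t c * t c' * (ε j ω c * ε j ω c') := by
    intro ω
    simp only [PiLp.inner_apply, RCLike.inner_apply, conj_trivial]
    rw [sq, Finset.sum_mul_sum]
    exact Finset.sum_congr rfl fun c _ => Finset.sum_congr rfl fun c' _ => by ring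
  have hi : ∀ c c', Integrable (fun ω => t c * t c' * (ε j ω c * ε j ω c')) P :=
    fun c c' => ((hL c).integrable_mul (hL c')).const_mul _
  simp only [h1]
  rw [integral_finsetSum _ fun c _ => integrable_finsetSum _ fun c' _ => hi c c']
  refine Finset.sum_congr rfl fun c _ => ?_
  rw [integral_finsetSum _ fun c' _ => hi c c']
  refine Finset.sum_congr rfl fun c' _ => ?_
  rw [integral_const_mul, covariance_eq_sub (hL c) (hL c'), h.mean_zero j c, zero_mul, sub_zero]
  rfl

/-- This is nonnegativity of the variance of `|f|`. -/
lemma sq_integral_abs_le {Ω : Type*} [MeasurableSpace Ω] {P : Measure Ω} [IsProbabilityMeasure P]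
    {f : Ω → ℝ} (hf : MemLp f 2 P) : (∫ ω, |f ω| ∂P) ^ 2 ≤ ∫ ω, f ω ^ 2 ∂P := by
  have h1 := variance_nonneg |f| P
  rw [variance_eq_sub hf.abs] at h1
  simp only [Pi.pow_apply, Pi.abs_apply, sq_abs] at h1
  linarith

/-- Perturbations with covariances `o(1 / n)` are negligible at the scale `1 / √n`. -/
lemma tendsto_charFun_sqrt_smul_of_isLittleO
    (hmodel : ∀ m, IsBatchModel p (P m) (n m) (ε m) (X m)) (j : Fin K)
    (hcov : ∀ c c' : Fin d, (fun m => cov[fun ω => ε m j ω c, fun ω => ε m j ω c'; P m])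
      =o[atTop] fun m => 1 / (n m j : ℝ)) (t : EuclideanSpace ℝ (Fin d)) :
    Tendsto (fun m => charFun ((P m).map fun ω => Real.sqrt (n m j) • ε m j ω) t)
      atTop (𝓝 (charFun (multivariateGaussian 0 (0 : Matrix (Fin d) (Fin d) ℝ)) t)) := by
  have hone : charFun (multivariateGaussian 0 (0 : Matrix (Fin d) (Fin d) ℝ)) t = 1 := by
    rw [charFun_multivariateGaussian Matrix.PosSemidef.zero]
    simp
  rw [hone]
  have hZ : ∀ m, Measurable fun ω => Real.sqrt (n m j) • ε m j ω :=
    fun m => ((hmodel m).measurable_perturbation j).const_smul (Real.sqrt (n m j))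
  have hv : Tendsto (fun m => ∑ c, ∑ c', t c * t c' *
      (cov[fun ω => ε m j ω c, fun ω => ε m j ω c'; P m] / (1 / (n m j : ℝ)))) atTop (𝓝 0) := by
    have := tendsto_finsetSum (Finset.univ : Finset (Fin d)) fun c _ =>
      tendsto_finsetSum (Finset.univ : Finset (Fin d)) fun c' _ =>
        ((hcov c c').tendsto_div_nhds_zero).const_mul (t c * t c')
    simpa using this
  have hsq : ∀ m, ∫ ω, (inner ℝ (Real.sqrt (n m j) • ε m j ω) t) ^ 2 ∂P m = ∑ c, ∑ c', t c * t c' *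
      (cov[fun ω => ε m j ω c, fun ω => ε m j ω c'; P m] / (1 / (n m j : ℝ))) := by
    intro m
    simp only [real_inner_smul_left, mul_pow, Real.sq_sqrt (Nat.cast_nonneg _)]
    rw [integral_const_mul, (hmodel m).integral_inner_sq j t, Finset.mul_sum]
    refine Finset.sum_congr rfl fun c _ => ?_
    rw [Finset.mul_sum]
    refine Finset.sum_congr rfl fun c' _ => ?_
    rw [div_div_eq_mul_div, div_one]
    ring
  rw [tendsto_iff_norm_sub_tendsto_zero]
  -- With `Z = √n ε`, the chain is `|E exp(i⟨Z,t⟩) - 1| ≤ E|⟨Z,t⟩| ≤ √(E⟨Z,t⟩²)`, and the last term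
  -- tends to `0` by `hv`.
  refine squeeze_zero (fun m => norm_nonneg _) (fun m => ?_) (by rw [← Real.sqrt_zero]; exact hv.sqrt)
  have hL : MemLp (fun ω => inner ℝ (Real.sqrt (n m j) • ε m j ω) t) 2 (P m) := by
    have : (fun ω => inner ℝ (Real.sqrt (n m j) • ε m j ω) t) =
        fun ω => ∑ c, (t c * Real.sqrt (n m j)) * ε m j ω c := by
      ext ω
      simp only [PiLp.inner_apply, RCLike.inner_apply, conj_trivial, PiLp.smul_apply, smul_eq_mul,
        mul_assoc]
    rw [this]
    exact memLp_finsetSum _ fun c _ => ((hmodel m).memLp_perturbation j c).const_mul _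
  rw [charFun_apply, integral_map (hZ m).aemeasurable (by fun_prop)]
  have hm : Measurable fun ω => Complex.exp
      ((inner ℝ (Real.sqrt (n m j) • ε m j ω) t : ℝ) * Complex.I) := by
    have := hZ m
    fun_prop
  have hi : Integrable (fun ω => Complex.exp
      ((inner ℝ (Real.sqrt (n m j) • ε m j ω) t : ℝ) * Complex.I)) (P m) :=
    Integrable.of_bound hm.aestronglyMeasurable 1
      (Eventually.of_forall fun ω => (Complex.norm_exp_ofReal_mul_I _).le)
  have h1 : ∫ ω, Complex.exp ((inner ℝ (Real.sqrt (n m j) • ε m j ω) t : ℝ) * Complex.I) ∂P m - 1 =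
      ∫ ω, (Complex.exp ((inner ℝ (Real.sqrt (n m j) • ε m j ω) t : ℝ) * Complex.I) - 1) ∂P m := by
    rw [integral_sub hi (integrable_const _)]
    simp
  rw [h1, ← hsq]
  refine le_trans ?_ (Real.le_sqrt_of_sq_le (sq_integral_abs_le hL))
  refine norm_integral_le_of_norm_le (hL.integrable one_le_two).abs (Eventually.of_forall fun ω => ?_)
  simpa using norm_exp_ofReal_mul_I_sub_exp_le (inner ℝ (Real.sqrt (n m j) • ε m j ω) t) 0

end Limit

/-! ### The two regimes combined. -/

theorem mainTheorem2 (d K : ℕ) (p : Fin (d + 1) → ℝ) (hp_sum : ∑ c, p c = 1)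
    (hp : ∀ c : Fin d, 0 < p c.castSucc ∧ p c.castSucc < 1) (a : ℝ) (ha : 0 < a)
    {Ω : ℕ → Type*} [∀ m, MeasurableSpace (Ω m)]
    (P : ∀ m, Measure (Ω m)) [∀ m, IsProbabilityMeasure (P m)]
    (n : ℕ → Fin K → ℕ) (ε : ∀ m, Fin K → Ω m → EuclideanSpace ℝ (Fin d))
    (X : ∀ m, Fin K → Ω m → Fin (d + 1) → ℕ)
    (hmodel : ∀ m, IsBatchModel p (P m) (n m) (ε m) (X m))
    (j : Fin K) (hn : Tendsto (fun m => n m j) atTop atTop) :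
    (∀ Ξ : Matrix (Fin d) (Fin d) ℝ, Ξ.PosDef →
      ScaledDensityTendsto P (fun m => n m j) (fun m => ε m j) Ξ →
        (arcsineLimitCov p Ξ).PosSemidef ∧
        TendstoInDistribution
          (fun m ω => Real.sqrt ((n m j : ℝ) + 0.5) •
            (arcsineTransform a (n m j) (X m j ω) - arcsineCentre p))
          atTop id P (multivariateGaussian 0 (arcsineLimitCov p Ξ))) ∧
    ((∀ c c' : Fin d,
        (fun m => cov[fun ω => ε m j ω c, fun ω => ε m j ω c'; P m])
          =o[atTop] fun m => 1 / (n m j : ℝ)) →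
        (∀ c, arcsineLimitCov p 0 c c = 1) ∧
        (∀ c c', c ≠ c' → arcsineLimitCov p 0 c c' =
          -Real.sqrt (p c.castSucc * p c'.castSucc /
            ((1 - p c.castSucc) * (1 - p c'.castSucc)))) ∧
        (arcsineLimitCov p 0).PosSemidef ∧
        TendstoInDistribution
          (fun m ω => Real.sqrt ((n m j : ℝ) + 0.5) •
            (arcsineTransform a (n m j) (X m j ω) - arcsineCentre p))
          atTop id P (multivariateGaussian 0 (arcsineLimitCov p 0))) := by
  have hp0 : ∀ c, 0 ≤ p c :=
    Fin.lastCases ((hmodel 0).cellProb_last_nonneg j) fun c => (hp c).1.le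
  refine ⟨fun Ξ hΞ hdens => ⟨posSemidef_arcsineLimitCov hp_sum hp0 hΞ.posSemidef, ?_⟩,
    fun hcov => ⟨fun c => arcsineLimitCov_zero_self (hp c),
      fun c c' hne => arcsineLimitCov_zero_of_ne (hp c) (hp c') hne,
      posSemidef_arcsineLimitCov hp_sum hp0 Matrix.PosSemidef.zero, ?_⟩⟩
  · exact tendstoInDistribution_arcsineTransform hp_sum hp hp0 a hmodel j hn hΞ.posSemidef
      (hdens.tendsto_charFun (fun m => (hmodel m).measurable_perturbation j) hΞ)
  · exact tendstoInDistribution_arcsineTransform hp_sum hp hp0 a hmodel j hn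
      Matrix.PosSemidef.zero (tendsto_charFun_sqrt_smul_of_isLittleO hmodel j hcov)
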